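/- Let $d\ge 2$ and let $\mathbb{T}_d$ be the homogeneous tree in which every vertex has $d+1$ neighbours, with a distinguished vertex $o$. Consider the frog model on $\mathbb{T}_d$ with parameter $p\in(0,1)$. At time $0$ there is one particle at each vertex; the particle at $o$ is active and all the others are inactive. From its activation on, a particle performs, independently of everything else, a simple random walk on $\mathbb{T}_d$ in discrete time, and makes a random number $L$ of jumps, where $\mathbb{P}(L=k)=(1-p)p^k$ for $k\ge 0$, after which it is removed. An inactive particle is activated as soon as an active particle visits its vertex. The process survives if at every time there is at least one active particle. Let $\theta(d,p)$ be the probability of survival, and let $p_c^{o}(d)=\inf\{p\in(0,1):\theta(d,p)>0\}$. Then $\{p\in(0,1):\theta(d,p)>0\}$ is non-empty for every $d\ge 2$. Moreover $p_c^{o}(2)\le 0.720836$, and for every $d\ge 3$ $$p_c^{o}(d)\le \frac{(d+1)\left[(7d-1)-\sqrt{(7d-1)^2-14}\right]}{d(7d-1)^2-7d+2-d(7d-1)\sqrt{(7d-1)^2-14}}<\frac{d+1}{2d}.$$ -/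

import Mathlib

open MeasureTheory ProbabilityTheory
open scoped ENNReal

namespace FrogModel

universe u

/-- The randomness attached to one particle: a sequence of maps `φ₀, φ₁, … : V → V` that drive its
walk (at its `n`-th jump, a particle sitting at `x` jumps to `φₙ x`), and its lifetime, that is,
the number of jumps it makes, once activated, before it is removed. -/
def Particle (V : Type u) : Type u := (ℕ → V → V) × ℕ

namespace Particle

variable {V : Type u}

/-- The maps that drive the walk of the particle. -/
def moves (x : Particle V) : ℕ → V → V := x.1

/-- The number of jumps that the particle makes before it is removed. -/
def lifetime (x : Particle V) : ℕ := x.2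

end Particle

/-- The product sigma-algebra, the vertex set being discrete. -/
instance (V : Type u) : MeasurableSpace (Particle V) :=
  letI : MeasurableSpace V := ⊤
  inferInstanceAs (MeasurableSpace ((ℕ → V → V) × ℕ))

/-- The walk started at `v` and driven by the maps `φₙ`: `S₀ = v` and `Sₙ₊₁ = φₙ Sₙ`. -/
def walk {V : Type u} (φ : ℕ → V → V) (v : V) : ℕ → V
  | 0 => v
  | n + 1 => φ n (walk φ v n)

/-- The law of one particle on a locally finite graph without isolated vertices. The values `φₙ x`
are independent over all `n` and `x`, and `φₙ x` is uniform among the neighbours of `x`; hence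
`walk φ v` is the simple random walk on `G` started at `v`. The lifetime `L` is independent of the
walk and geometric with parameter `1 - p`: `ℙ(L = k) = (1 - p) * p ^ k` for `k = 0, 1, 2, …`
(for `p < 1`), i.e. before each jump the particle is removed with probability `1 - p`. -/
noncomputable def particleLaw {V : Type u} (G : SimpleGraph V) (p : unitInterval) :
    Measure (Particle V) :=
  letI : MeasurableSpace V := ⊤
  (Measure.infinitePi fun _ : ℕ => Measure.infinitePi fun x : V => uniformOn (G.neighborSet x)).prod
    (geometricMeasure (unitInterval.symm p))

/-- The law of the whole system: one particle per vertex, independent and with the same law. -/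
noncomputable def frogLaw {V : Type u} (G : SimpleGraph V) (p : unitInterval) :
    Measure (V → Particle V) :=
  Measure.infinitePi fun _ : V => particleLaw G p

/-- `Reaches o ω v t`: there is a chain of particles, the first one being the particle of `o`
starting at time `0`, each particle of the chain starting to walk when the previous one (still
alive) sits at its vertex, and such that `v` is reached in this way at time `t`. The least such
`t` is the time at which the particle of `v` is activated. -/
inductive Reaches {V : Type u} (o : V) (ω : V → Particle V) : V → ℕ → Prop
  | root : Reaches o ω o 0
  | step {v : V} {t n : ℕ} (h : Reaches o ω v t) (hn : n ≤ (ω v).lifetime) :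
      Reaches o ω (walk (ω v).moves v n) (t + n)

/-- The particle of `v` is activated at time `t`. -/
def ActivatedAt {V : Type u} (o : V) (ω : V → Particle V) (v : V) (t : ℕ) : Prop :=
  IsLeast {s | Reaches o ω v s} t

/-- The particle of `v` is active (activated and not yet removed) at time `t`. -/
def ActiveAt {V : Type u} (o : V) (ω : V → Particle V) (v : V) (t : ℕ) : Prop :=
  ∃ s, ActivatedAt o ω v s ∧ s ≤ t ∧ t ≤ s + (ω v).lifetime

/-- The process started from the particle of `o` survives: at every time there is at least one
active particle. -/
def Survives {V : Type u} (o : V) (ω : V → Particle V) : Prop :=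
  ∀ t, ∃ v, ActiveAt o ω v t

/-- The probability of survival `θ(p)`. -/
noncomputable def survivalProb {V : Type u} (G : SimpleGraph V) (o : V) (p : unitInterval) : ℝ≥0∞ :=
  frogLaw G p {ω | Survives o ω}

/-- The set of the `p ∈ (0, 1)` for which the process survives with positive probability. -/
def supercritical {V : Type u} (G : SimpleGraph V) (o : V) : Set ℝ :=
  {x | ∃ p : unitInterval, (p : ℝ) = x ∧ 0 < p ∧ p < 1 ∧ 0 < survivalProb G o p}

/-- The critical parameter `inf {p : θ(p) > 0}`. -/
noncomputable def criticalParam {V : Type u} (G : SimpleGraph V) (o : V) : ℝ :=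
  sInf (supercritical G o)

end FrogModel

/-!
Only the particles of a `d`-ary subtree rooted at `o` are followed, and each only down its own
subtree, where a fixed vertex at distance `k` is visited with probability `b ^ k`; by harmonicity
`p * (1 + d * b ^ 2) = (d + 1) * b`. A vertex is activated if the path leading to it is covered,
that is, if each vertex on the path is visited by the particle of an earlier one. Decomposing by
the nearest ancestor whose particle visits the end of the path bounds the probability of covering
a path from below by the solution of a renewal equation with increments
`b ^ (i + 1) * (1 - b) * ... * (1 - b ^ i)`. If these increments, multiplied by `d ^ (i + 1)`, have
sum greater than `1`, then the mean number of covered paths of length `n` tends to infinity with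
`n`, so for some `n` it exceeds `1`: the covered paths of length `n` dominate a supercritical
branching process, and the second moment method bounds its survival probability away from `0`. The
sum is estimated through `(1 - b) * ... * (1 - b ^ i) ≥ 1 - b - b ^ 2`, a truncation of Euler's
pentagonal number series.
-/

namespace FrogModel

section Independence

variable {Ω ι κ : Type*} {mΩ : MeasurableSpace Ω} {μ : Measure Ω} {m : ι → MeasurableSpace Ω}

/-- The sigma-algebra generated by the sigma-algebras `m i` with `i ∈ S`: what is known once the
randomness attached to the indices in `S` is revealed. -/
abbrev sigmaOn (m : ι → MeasurableSpace Ω) (S : Set ι) : MeasurableSpace Ω := ⨆ i ∈ S, m i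

lemma sigmaOn_mono {S T : Set ι} (h : S ⊆ T) : sigmaOn m S ≤ sigmaOn m T :=
  biSup_mono h

lemma le_sigmaOn {S : Set ι} {i : ι} (hi : i ∈ S) : m i ≤ sigmaOn m S :=
  le_biSup m hi

lemma sigmaOn_le (hm : ∀ i, m i ≤ mΩ) (S : Set ι) : sigmaOn m S ≤ mΩ :=
  iSup₂_le fun i _ => hm i

lemma measureReal_inter_of_disjoint (hm : ∀ i, m i ≤ mΩ) (hind : iIndep m μ) {S T : Set ι}
    (hST : Disjoint S T) {A B : Set Ω} (hA : MeasurableSet[sigmaOn m S] A)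
    (hB : MeasurableSet[sigmaOn m T] B) : μ.real (A ∩ B) = μ.real A * μ.real B := by
  simp only [Measure.real, ← ENNReal.toReal_mul,
    (Indep_iff _ _ _).1 (indep_iSup_of_disjoint hm hind hST) A B hA hB]

lemma measurableSet_sigmaOn_biInter {t : Finset κ} {g : κ → ι} {E : κ → Set Ω}
    (hE : ∀ j ∈ t, MeasurableSet[m (g j)] (E j)) :
    MeasurableSet[sigmaOn m (g '' t)] (⋂ j ∈ t, E j) :=
  Finset.measurableSet_biInter t fun j hj =>
    le_sigmaOn (Set.mem_image_of_mem g (Finset.mem_coe.2 hj)) _ (hE j hj)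

lemma measureReal_biInter_of_injOn [IsProbabilityMeasure μ] (hm : ∀ i, m i ≤ mΩ)
    (hind : iIndep m μ) {t : Finset κ} {g : κ → ι} (hg : Set.InjOn g t) {E : κ → Set Ω}
    (hE : ∀ j ∈ t, MeasurableSet[m (g j)] (E j)) :
    μ.real (⋂ j ∈ t, E j) = ∏ j ∈ t, μ.real (E j) := by
  classical
  induction t using Finset.induction_on with
  | empty => simp
  | insert i t hi ih =>
    rw [Finset.coe_insert, Set.injOn_insert (by simpa using hi)] at hg
    rw [Finset.forall_mem_insert] at hE
    rw [Finset.set_biInter_insert, Finset.prod_insert hi, ← ih hg.1 hE.2]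
    exact measureReal_inter_of_disjoint hm hind (Set.disjoint_singleton_left.2 hg.2)
      (le_sigmaOn (Set.mem_singleton _) _ hE.1) (measurableSet_sigmaOn_biInter hE.2)

lemma disjointed_eq_inter_biInter_range (F : ℕ → Set Ω) (i : ℕ) :
    disjointed F i = F i ∩ ⋂ j ∈ Finset.range i, (F j)ᶜ := by
  simp only [disjointed_eq_inter_compl, Finset.mem_range]

lemma measurableSet_sigmaOn_disjointed {g : ℕ → ι} {F : ℕ → Set Ω} {i : ℕ}
    (hF : ∀ j ≤ i, MeasurableSet[m (g j)] (F j)) :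
    MeasurableSet[sigmaOn m (g '' Set.Iic i)] (disjointed F i) := by
  have hmem {j : ℕ} (hj : j ≤ i) : MeasurableSet[sigmaOn m (g '' Set.Iic i)] (F j) :=
    le_sigmaOn (Set.mem_image_of_mem g (Set.mem_Iic.2 hj)) _ (hF j hj)
  rw [disjointed_eq_inter_biInter_range]
  exact (hmem le_rfl).inter (Finset.measurableSet_biInter _ fun j hj =>
    (hmem (Finset.mem_range.1 hj).le).compl)

lemma measureReal_disjointed [IsProbabilityMeasure μ] (hm : ∀ i, m i ≤ mΩ) (hind : iIndep m μ)
    {g : ℕ → ι} {F : ℕ → Set Ω} {i : ℕ} (hg : Set.InjOn g (Set.Iic i))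
    (hF : ∀ j ≤ i, MeasurableSet[m (g j)] (F j)) :
    μ.real (disjointed F i) = μ.real (F i) * ∏ j ∈ Finset.range i, (1 - μ.real (F j)) := by
  have hle {j : ℕ} (hj : j ∈ Finset.range i) : j ≤ i := (Finset.mem_range.1 hj).le
  have hcompl : ∀ j ∈ Finset.range i, MeasurableSet[m (g j)] (F j)ᶜ := fun j hj =>
    (hF j (hle hj)).compl
  have hi : g i ∉ g '' (Finset.range i : Set ℕ) := by
    rintro ⟨j, hj, hij⟩
    exact (Finset.mem_range.1 hj).ne (hg (hle hj) (Set.mem_Iic.2 le_rfl) hij)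
  rw [disjointed_eq_inter_biInter_range, measureReal_inter_of_disjoint hm hind
    (Set.disjoint_singleton_left.2 hi) (le_sigmaOn (Set.mem_singleton _) _ (hF i le_rfl))
    (measurableSet_sigmaOn_biInter hcompl),
    measureReal_biInter_of_injOn hm hind (hg.mono fun j hj => hle hj) hcompl]
  congr 1
  exact Finset.prod_congr rfl fun j hj => probReal_compl_eq_one_sub (hm _ _ (hF j (hle hj)))

end Independence

section Renewal

variable {a : ℕ → ℝ}

/-- The renewal sequence `u₀ = 1`, `uₙ₊₁ = ∑_{i ≤ n} aᵢ uₙ₋ᵢ`; the increment `i + 1` has the weight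
`a i`, the total weight being arbitrary. -/
noncomputable def renewal (a : ℕ → ℝ) : ℕ → ℝ
  | 0 => 1
  | n + 1 => ∑ i : Fin (n + 1), a i * renewal a (n - i)

lemma renewal_zero (a : ℕ → ℝ) : renewal a 0 = 1 := by
  rw [renewal]

lemma renewal_succ (a : ℕ → ℝ) (n : ℕ) :
    renewal a (n + 1) = ∑ i ∈ Finset.range (n + 1), a i * renewal a (n - i) := by
  rw [renewal, Finset.sum_range]

lemma renewal_pow_mul (c : ℝ) (a : ℕ → ℝ) (n : ℕ) :
    renewal (fun i => c ^ (i + 1) * a i) n = c ^ n * renewal a n := by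
  induction n using Nat.strong_induction_on with
  | _ n ih =>
  cases n with
  | zero => simp only [renewal_zero, pow_zero, one_mul]
  | succ n =>
    rw [renewal_succ, renewal_succ, Finset.mul_sum]
    refine Finset.sum_congr rfl fun i hi => ?_
    have hi : i ≤ n := Finset.mem_range_succ_iff.1 hi
    have hpow : c ^ (n + 1) = c ^ (i + 1) * c ^ (n - i) := by rw [← pow_add]; congr 1; omega
    rw [ih (n - i) (by omega), hpow]
    ring

lemma renewal_pos (ha : ∀ i, 0 ≤ a i) (ha0 : 0 < a 0) (n : ℕ) : 0 < renewal a n := by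
  induction n using Nat.strong_induction_on with
  | _ n ih =>
  cases n with
  | zero => rw [renewal_zero]; exact one_pos
  | succ n =>
    rw [renewal_succ]
    exact Finset.sum_pos' (fun i _ => mul_nonneg (ha i) (ih _ (by omega)).le)
      ⟨0, by simp, mul_pos ha0 (ih _ (by omega))⟩

lemma mul_pow_div_le_renewal (ha : ∀ i, 0 ≤ a i) (ha0 : 0 < a 0) {M : ℕ}
    (hM : 1 ≤ ∑ i ∈ Finset.range M, a i) {c : ℝ} (hc0 : 0 ≤ c) (hc : ∀ n < M, c ≤ renewal a n)
    (n : ℕ) : c * (∑ i ∈ Finset.range M, a i) ^ (n / M) ≤ renewal a n := by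
  set S := ∑ i ∈ Finset.range M, a i with hS
  induction n using Nat.strong_induction_on with
  | _ n ih =>
  rcases lt_or_ge n M with hn | hn
  · simpa [Nat.div_eq_of_lt hn] using hc n hn
  · have hM0 : 0 < M := Nat.pos_of_ne_zero fun h => by
      rw [hS, h, Finset.sum_range_zero] at hM
      exact absurd hM (by norm_num)
    obtain ⟨n, rfl⟩ : ∃ k, n = k + 1 := ⟨n - 1, by omega⟩
    have hdiv (i : ℕ) (hi : i < M) : (n + 1) / M - 1 ≤ (n - i) / M := by
      rw [Nat.sub_le_iff_le_add, ← Nat.add_div_right _ hM0]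
      exact Nat.div_le_div_right (by omega)
    calc c * S ^ ((n + 1) / M) = ∑ i ∈ Finset.range M, a i * (c * S ^ ((n + 1) / M - 1)) := by
          rw [← Finset.sum_mul, ← hS, mul_left_comm, mul_pow_sub_one (Nat.div_pos hn hM0).ne']
      _ ≤ ∑ i ∈ Finset.range M, a i * renewal a (n - i) := by
          refine Finset.sum_le_sum fun i hi => mul_le_mul_of_nonneg_left ?_ (ha i)
          refine le_trans ?_ (ih (n - i) (by omega))
          gcongr
          exact hdiv i (Finset.mem_range.1 hi)
      _ ≤ renewal a (n + 1) := by
          rw [renewal_succ]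
          exact Finset.sum_le_sum_of_subset_of_nonneg (Finset.range_subset_range.2 hn)
            fun i _ _ => mul_nonneg (ha i) (renewal_pos ha ha0 _).le

lemma tendsto_renewal_atTop (ha : ∀ i, 0 ≤ a i) (ha0 : 0 < a 0) {M : ℕ}
    (hM : 1 < ∑ i ∈ Finset.range M, a i) :
    Filter.Tendsto (renewal a) Filter.atTop Filter.atTop := by
  have hM0 : M ≠ 0 := by
    rintro rfl
    rw [Finset.sum_range_zero] at hM
    exact absurd hM (by norm_num)
  obtain ⟨k, -, hk⟩ := Finset.exists_min_image (Finset.range M) (renewal a)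
    (Finset.nonempty_range_iff.2 hM0)
  have hk0 : 0 < renewal a k := renewal_pos ha ha0 k
  refine Filter.tendsto_atTop_mono (mul_pow_div_le_renewal ha ha0 hM.le hk0.le fun n hn =>
    hk n (Finset.mem_range.2 hn)) ?_
  exact ((tendsto_pow_atTop_atTop_of_one_lt hM).comp
    (Nat.tendsto_div_const_atTop hM0)).const_mul_atTop hk0

end Renewal

section Words

variable {Ω α : Type*} {mΩ : MeasurableSpace Ω} {μ : Measure Ω} {m : List α → MeasurableSpace Ω}
  {A : List α → List α → Set Ω} {q : ℕ → ℝ}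

/-- The vertices below a given one are indexed by words, `s ++ l` being the descendant of `l`
reached by reading `s` from its last letter. If `A l s` is the event that the particle of `l` visits
`s ++ l`, then `ancestorHit A l s a i` is the event that `a :: s ++ l` is visited by the particle
sitting `i + 1` generations above it. -/
def ancestorHit (A : List α → List α → Set Ω) (l s : List α) (a : α) (i : ℕ) : Set Ω :=
  A (s.drop i ++ l) (a :: s.take i)

/-- The event that each vertex of the path from `l` down to `s ++ l`, except `l`, is visited by the
particle of an earlier vertex of this path. -/
def covered (A : List α → List α → Set Ω) (l : List α) : List α → Set Ω
  | [] => Set.univ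
  | a :: s => covered A l s ∩ ⋃ i ∈ Finset.range (s.length + 1), ancestorHit A l s a i

lemma mem_covered_append (hmono : ∀ l s t, A l (t ++ s) ⊆ A l s) {l s r : List α} {ω : Ω}
    (hr : ω ∈ covered A l r) (hs : ω ∈ A (r ++ l) s) : ω ∈ covered A l (s ++ r) := by
  induction s with
  | nil => exact hr
  | cons a s ih =>
    refine ⟨ih (hmono _ s [a] hs), ?_⟩
    simp only [Set.mem_iUnion, Finset.mem_range]
    exact ⟨s.length, by simp, by simpa [ancestorHit] using hs⟩

lemma mem_of_mem_covered {R : List α → Prop} {ω : Ω}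
    (hR : ∀ l s, R l → ω ∈ A l s → R (s ++ l)) {l s : List α} (hl : R l)
    (hs : ω ∈ covered A l s) (i : ℕ) : R (s.drop i ++ l) := by
  induction s generalizing i with
  | nil => simpa using hl
  | cons a s ih =>
    obtain ⟨hs, ha⟩ := hs
    cases i with
    | succ i => exact ih hs i
    | zero =>
      simp only [Set.mem_iUnion] at ha
      obtain ⟨j, -, hj⟩ := ha
      simpa [← List.append_assoc] using hR _ _ (ih hs j) hj

lemma measurableSet_covered (hA : ∀ l s, MeasurableSet[m l] (A l s)) (l s : List α) :
    MeasurableSet[sigmaOn m {l' | l <:+ l' ∧ l'.length < l.length + s.length}]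
      (covered A l s) := by
  induction s with
  | nil => exact MeasurableSet.univ
  | cons a s ih =>
    refine MeasurableSet.inter (sigmaOn_mono ?_ _ ih)
      (Finset.measurableSet_biUnion _ fun i _ => le_sigmaOn ?_ _ (hA (s.drop i ++ l) _))
    · exact fun l' h => ⟨h.1, h.2.trans (by simp)⟩
    · refine ⟨List.suffix_append _ _, ?_⟩
      simp only [List.length_cons, List.length_append, List.length_drop]
      omega

/-- If a particle visits a given descendant at distance `k` with probability `q k`, the probability
that a given vertex is visited from `i + 1` generations above but from none of the `i` generations
in between. -/
noncomputable def lastHit (q : ℕ → ℝ) (i : ℕ) : ℝ :=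
  q (i + 1) * ∏ j ∈ Finset.range i, (1 - q (j + 1))

lemma injOn_drop_append (l s : List α) : Set.InjOn (fun j => s.drop j ++ l) (Set.Iic s.length) := by
  intro i hi j hj hij
  have hlen := congrArg List.length hij
  simp only [List.length_append, List.length_drop, Set.mem_Iic] at hi hj hlen
  omega

variable [IsProbabilityMeasure μ]

lemma measureReal_disjointed_ancestorHit (hm : ∀ l, m l ≤ mΩ) (hind : iIndep m μ)
    (hA : ∀ l s, MeasurableSet[m l] (A l s)) (hP : ∀ l s, μ.real (A l s) = q s.length)
    (l s : List α) (a : α) {i : ℕ} (hi : i ≤ s.length) :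
    μ.real (disjointed (ancestorHit A l s a) i) = lastHit q i := by
  have hq {j : ℕ} (hj : j ≤ i) : μ.real (ancestorHit A l s a j) = q (j + 1) := by
    rw [ancestorHit, hP, List.length_cons, List.length_take_of_le (hj.trans hi)]
  rw [measureReal_disjointed (F := ancestorHit A l s a) hm hind
    ((injOn_drop_append l s).mono (Set.Iic_subset_Iic.2 hi)) fun j _ => hA _ _, hq le_rfl, lastHit]
  congr 1
  exact Finset.prod_congr rfl fun j hj => by rw [hq (Finset.mem_range.1 hj).le]

lemma measureReal_covered_inter_disjointed (hm : ∀ l, m l ≤ mΩ) (hind : iIndep m μ)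
    (hA : ∀ l s, MeasurableSet[m l] (A l s)) (hP : ∀ l s, μ.real (A l s) = q s.length)
    (l s : List α) (a : α) {i : ℕ} (hi : i ≤ s.length) :
    μ.real (covered A l (s.drop i) ∩ disjointed (ancestorHit A l s a) i) =
      μ.real (covered A l (s.drop i)) * lastHit q i := by
  rw [measureReal_inter_of_disjoint hm hind ?_ (measurableSet_covered hA l _)
    (measurableSet_sigmaOn_disjointed (F := ancestorHit A l s a) (g := fun j => s.drop j ++ l)
      fun j _ => hA _ _), measureReal_disjointed_ancestorHit hm hind hA hP l s a hi]
  refine Set.disjoint_left.2 ?_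
  rintro l' ⟨-, hl'⟩ ⟨j, hj, rfl⟩
  simp only [List.length_append, List.length_drop, Set.mem_Iic] at hl' hj
  omega

lemma covered_inter_disjointed_subset (hmono : ∀ l s t, A l (t ++ s) ⊆ A l s) (l s : List α)
    (a : α) (i : ℕ) :
    covered A l (s.drop i) ∩ disjointed (ancestorHit A l s a) i ⊆ covered A l (a :: s) := by
  rintro ω ⟨hs, hi⟩
  simpa using mem_covered_append hmono hs (disjointed_subset (ancestorHit A l s a) i hi)

lemma renewal_le_measureReal_covered (hm : ∀ l, m l ≤ mΩ) (hind : iIndep m μ)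
    (hA : ∀ l s, MeasurableSet[m l] (A l s)) (hP : ∀ l s, μ.real (A l s) = q s.length)
    (hmono : ∀ l s t, A l (t ++ s) ⊆ A l s) (l s : List α) :
    renewal (lastHit q) s.length ≤ μ.real (covered A l s) := by
  induction h : s.length using Nat.strong_induction_on generalizing s with
  | _ n ih =>
  subst h
  cases s with
  | nil => simp [covered, renewal_zero]
  | cons a s =>
    set D : ℕ → Set Ω := fun i => covered A l (s.drop i) ∩ disjointed (ancestorHit A l s a) i
    have hD_disj : Pairwise (Function.onFun Disjoint D) := fun i j hij =>
      (disjoint_disjointed _ hij).mono Set.inter_subset_right Set.inter_subset_right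
    have hD_meas (i : ℕ) : MeasurableSet (D i) :=
      (sigmaOn_le hm _ _ (measurableSet_covered hA l _)).inter
        (MeasurableSet.disjointed (fun j => hm _ _ (hA _ _)) i)
    calc renewal (lastHit q) (s.length + 1)
        = ∑ i ∈ Finset.range (s.length + 1), lastHit q i * renewal (lastHit q) (s.length - i) :=
          renewal_succ _ _
      _ ≤ ∑ i ∈ Finset.range (s.length + 1), μ.real (D i) := by
          refine Finset.sum_le_sum fun i hi => ?_
          have hi : i ≤ s.length := Finset.mem_range_succ_iff.1 hi
          rw [measureReal_covered_inter_disjointed hm hind hA hP l s a hi, mul_comm]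
          refine mul_le_mul_of_nonneg_right (ih _ (by simp) (s.drop i) (by simp)) ?_
          rw [← measureReal_disjointed_ancestorHit hm hind hA hP l s a hi]
          exact measureReal_nonneg
      _ = μ.real (⋃ i ∈ Finset.range (s.length + 1), D i) :=
          (measureReal_biUnion_finset (hD_disj.set_pairwise _) fun i _ => hD_meas i).symm
      _ ≤ μ.real (covered A l (a :: s)) := measureReal_mono <|
          Set.iUnion₂_subset fun i _ => covered_inter_disjointed_subset hmono l s a i

end Words

section SecondMoment

variable {Ω ι : Type*} {mΩ : MeasurableSpace Ω} {μ : Measure Ω} [IsProbabilityMeasure μ] [Fintype ι]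

lemma two_mul_sum_sub_le_measureReal_iUnion {E : ι → Set Ω} (hE : ∀ i, MeasurableSet (E i))
    (v : ι → ℝ) :
    2 * ∑ i, v i * μ.real (E i) - ∑ i, ∑ j, v i * v j * μ.real (E i ∩ E j) ≤
      μ.real (⋃ i, E i) := by
  set X : Ω → ℝ := fun ω => ∑ i, v i * (E i).indicator 1 ω
  have hX_sq (ω : Ω) : X ω ^ 2 = ∑ i, ∑ j, v i * v j * (E i ∩ E j).indicator 1 ω := by
    rw [sq, Finset.sum_mul_sum]
    refine Finset.sum_congr rfl fun i _ => Finset.sum_congr rfl fun j _ => ?_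
    rw [Set.inter_indicator_one, Pi.mul_apply]
    ring
  have hint {S : Set Ω} (hS : MeasurableSet S) (c : ℝ) :
      Integrable (fun ω => c * S.indicator (1 : Ω → ℝ) ω) μ :=
    ((integrable_const 1).indicator hS).const_mul c
  have hX : Integrable X μ := integrable_finsetSum _ fun i _ => hint (hE i) _
  have hpair (i j : ι) := hint ((hE i).inter (hE j)) (v i * v j)
  have hX2 : Integrable (fun ω => X ω ^ 2) μ := by
    simp only [hX_sq]
    exact integrable_finsetSum _ fun i _ => integrable_finsetSum _ fun j _ => hpair i j
  have hmean : ∫ ω, X ω ∂μ = ∑ i, v i * μ.real (E i) := by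
    rw [integral_finsetSum _ fun i _ => hint (hE i) _]
    simp only [integral_const_mul, integral_indicator_one (hE _)]
  have hmean_sq : ∫ ω, X ω ^ 2 ∂μ = ∑ i, ∑ j, v i * v j * μ.real (E i ∩ E j) := by
    simp only [hX_sq]
    rw [integral_finsetSum _ fun i _ => integrable_finsetSum _ fun j _ => hpair i j]
    simp only [integral_finsetSum _ fun j _ => hpair _ j, integral_const_mul,
      integral_indicator_one ((hE _).inter (hE _))]
  have hU : MeasurableSet (⋃ i, E i) := MeasurableSet.iUnion hE
  rw [← hmean, ← hmean_sq, ← integral_const_mul, ← integral_sub (hX.const_mul 2) hX2,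
    ← integral_indicator_one hU]
  refine integral_mono ((hX.const_mul 2).sub hX2) ((integrable_const 1).indicator hU) fun ω => ?_
  by_cases hω : ω ∈ ⋃ i, E i
  · rw [Set.indicator_of_mem hω]
    simp only [Pi.one_apply]
    nlinarith only [sq_nonneg (X ω - 1)]
  · have hX0 : X ω = 0 := Finset.sum_eq_zero fun i _ => by
      rw [Set.indicator_of_notMem fun h => hω (Set.mem_iUnion.2 ⟨i, h⟩), mul_zero]
    rw [Set.indicator_of_notMem hω]
    simp [hX0]

lemma sum_sum_mul_measureReal_inter_le {E B : ι → Set Ω} (hEB : ∀ i, E i ⊆ B i)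
    (hBB : Pairwise fun i j => μ.real (B i ∩ B j) = μ.real (B i) * μ.real (B j)) {v : ι → ℝ}
    (hv : ∀ i, 0 ≤ v i) :
    ∑ i, ∑ j, v i * v j * μ.real (E i ∩ E j) ≤
      ∑ i, v i ^ 2 * μ.real (E i) + (∑ i, v i * μ.real (B i)) ^ 2 := by
  classical
  rw [sq (∑ i, v i * μ.real (B i)), Finset.sum_mul_sum, ← Finset.sum_add_distrib]
  refine Finset.sum_le_sum fun i _ => ?_
  calc ∑ j, v i * v j * μ.real (E i ∩ E j)
      ≤ ∑ j, ((if i = j then v i ^ 2 * μ.real (E i) else 0) +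
          v i * μ.real (B i) * (v j * μ.real (B j))) := by
        refine Finset.sum_le_sum fun j _ => ?_
        split_ifs with hij
        · subst hij
          rw [Set.inter_self, ← sq]
          exact le_add_of_nonneg_right (mul_self_nonneg _)
        · rw [zero_add, mul_mul_mul_comm, ← hBB hij]
          exact mul_le_mul_of_nonneg_left
            (measureReal_mono (Set.inter_subset_inter (hEB i) (hEB j))) (mul_nonneg (hv i) (hv j))
    _ = v i ^ 2 * μ.real (E i) + ∑ j, v i * μ.real (B i) * (v j * μ.real (B j)) := by
        rw [Finset.sum_add_distrib, Finset.sum_ite_eq, if_pos (Finset.mem_univ i)]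

lemma le_measureReal_iUnion_inter {C B : ι → Set Ω} (hC : ∀ i, MeasurableSet (C i))
    (hB : ∀ i, MeasurableSet (B i)) (hCB : ∀ i, μ.real (C i ∩ B i) = μ.real (C i) * μ.real (B i))
    (hBB : Pairwise fun i j => μ.real (B i ∩ B j) = μ.real (B i) * μ.real (B j)) {c S : ℝ}
    (hc : 0 < c) (hcB : ∀ i, c ≤ μ.real (B i)) (hS : 0 < S) (hSC : ∑ i, μ.real (C i) = S)
    (hcS : (Fintype.card ι : ℝ) ^ 2 * c ≤ S ^ 2 - S) : c ≤ μ.real (⋃ i, C i ∩ B i) := by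
  -- With these weights the `v i * μ.real (B i)` are all equal and the first moment is `c`.
  set v : ι → ℝ := fun i => c / (S * μ.real (B i))
  have hB0 (i : ι) : 0 < μ.real (B i) := hc.trans_le (hcB i)
  have hv0 (i : ι) : 0 ≤ v i := div_nonneg hc.le (mul_pos hS (hB0 i)).le
  have hvS (i : ι) : v i ≤ 1 / S := by
    rw [div_le_div_iff₀ (mul_pos hS (hB0 i)) hS, one_mul, mul_comm]
    exact mul_le_mul_of_nonneg_left (hcB i) hS.le
  have hvB (i : ι) : v i * μ.real (B i) = c / S := by
    rw [div_mul_eq_mul_div, mul_div_mul_right _ _ (hB0 i).ne']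
  have hmean : ∑ i, v i * μ.real (C i ∩ B i) = c := by
    calc ∑ i, v i * μ.real (C i ∩ B i) = ∑ i, c / S * μ.real (C i) :=
          Finset.sum_congr rfl fun i _ => by rw [hCB, ← hvB i]; ring
      _ = c := by rw [← Finset.mul_sum, hSC, div_mul_cancel₀ _ hS.ne']
  have hdiag : ∑ i, v i ^ 2 * μ.real (C i ∩ B i) ≤ c / S := by
    calc ∑ i, v i ^ 2 * μ.real (C i ∩ B i) ≤ ∑ i, 1 / S * (v i * μ.real (C i ∩ B i)) := by
          refine Finset.sum_le_sum fun i _ => ?_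
          rw [sq, mul_assoc]
          exact mul_le_mul_of_nonneg_right (hvS i) (mul_nonneg (hv0 i) measureReal_nonneg)
      _ = c / S := by rw [← Finset.mul_sum, hmean, one_div_mul_eq_div]
  have hpairs := sum_sum_mul_measureReal_inter_le (μ := μ)
    (fun i => Set.inter_subset_right (s := C i)) hBB hv0
  have hoff : c / S + (∑ i, v i * μ.real (B i)) ^ 2 ≤ c := by
    simp only [hvB, Finset.sum_const, Finset.card_univ, nsmul_eq_mul]
    calc c / S + (Fintype.card ι * (c / S)) ^ 2
        = c * (S + (Fintype.card ι : ℝ) ^ 2 * c) / S ^ 2 := by field_simp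
      _ ≤ c * S ^ 2 / S ^ 2 := by gcongr; linarith
      _ = c := mul_div_cancel_right₀ _ (pow_pos hS 2).ne'
  have hmoment := two_mul_sum_sub_le_measureReal_iUnion (μ := μ) (fun i => (hC i).inter (hB i)) v
  linarith

end SecondMoment

section Branching

variable {Ω α : Type*} {mΩ : MeasurableSpace Ω} {μ : Measure Ω} {m : List α → MeasurableSpace Ω}
  {A : List α → List α → Set Ω} {q : ℕ → ℝ}

/-- The event that the branching process in which the children of `l` are the `s ++ l` with `s` of
length `n` and the path from `l` to `s ++ l` covered, started at `l`, survives for `k`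
generations. -/
def branching (A : List α → List α → Set Ω) (n : ℕ) : ℕ → List α → Set Ω
  | 0, _ => Set.univ
  | k + 1, l => ⋃ s : Fin n → α, covered A l (List.ofFn s) ∩ branching A n k (List.ofFn s ++ l)

lemma antitone_branching (n : ℕ) (l : List α) : Antitone fun k => branching A n k l := by
  refine antitone_nat_of_succ_le fun k => ?_
  induction k generalizing l with
  | zero => exact Set.subset_univ _
  | succ k ih => exact Set.iUnion_mono fun s => Set.inter_subset_inter_right _ (ih _)

lemma exists_length_eq_of_mem_branching {R : List α → Prop} {ω : Ω}
    (hR : ∀ l s, R l → ω ∈ A l s → R (s ++ l)) {n k : ℕ} {l : List α} (hl : R l)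
    (h : ω ∈ branching A n k l) : ∃ s, R s ∧ s.length = k * n + l.length := by
  induction k generalizing l with
  | zero => exact ⟨l, hl, by simp⟩
  | succ k ih =>
    obtain ⟨s, hs, hk⟩ := Set.mem_iUnion.1 h
    obtain ⟨t, ht, hlen⟩ := ih (by simpa using mem_of_mem_covered hR hl hs 0) hk
    refine ⟨t, ht, ?_⟩
    rw [hlen, List.length_append, List.length_ofFn, add_one_mul, add_assoc]

lemma measurableSet_branching [Finite α] (hA : ∀ l s, MeasurableSet[m l] (A l s)) (n k : ℕ)
    (l : List α) : MeasurableSet[sigmaOn m {l' | l <:+ l'}] (branching A n k l) := by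
  induction k generalizing l with
  | zero => exact MeasurableSet.univ
  | succ k ih =>
    refine MeasurableSet.iUnion fun s => MeasurableSet.inter ?_ ?_
    · exact sigmaOn_mono (fun l' h => h.1) _ (measurableSet_covered hA l _)
    · exact sigmaOn_mono (fun l' h => (List.suffix_append _ _).trans h) _ (ih _)

lemma measureReal_covered_inter_branching [Finite α] (hm : ∀ l, m l ≤ mΩ) (hind : iIndep m μ)
    (hA : ∀ l s, MeasurableSet[m l] (A l s)) (n k : ℕ) (l s : List α) :
    μ.real (covered A l s ∩ branching A n k (s ++ l)) =
      μ.real (covered A l s) * μ.real (branching A n k (s ++ l)) := by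
  refine measureReal_inter_of_disjoint hm hind ?_ (measurableSet_covered hA l s)
    (measurableSet_branching hA n k (s ++ l))
  refine Set.disjoint_left.2 fun l' hcov hbr => ?_
  have hle := List.IsSuffix.length_le hbr
  have hlt := hcov.2
  rw [List.length_append] at hle
  omega

lemma measureReal_branching_inter_branching [Finite α] (hm : ∀ l, m l ≤ mΩ) (hind : iIndep m μ)
    (hA : ∀ l s, MeasurableSet[m l] (A l s)) (n k : ℕ) {l l' : List α}
    (hlen : l.length = l'.length) (hne : l ≠ l') :
    μ.real (branching A n k l ∩ branching A n k l') =
      μ.real (branching A n k l) * μ.real (branching A n k l') := by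
  refine measureReal_inter_of_disjoint hm hind ?_ (measurableSet_branching hA n k l)
    (measurableSet_branching hA n k l')
  exact Set.disjoint_left.2 fun r hl hl' => hne <|
    (List.suffix_of_suffix_length_le hl hl' hlen.le).eq_of_length hlen

lemma lastHit_nonneg (hq0 : ∀ k, 0 ≤ q k) (hq1 : ∀ k, q k ≤ 1) (i : ℕ) : 0 ≤ lastHit q i :=
  mul_nonneg (hq0 _) (Finset.prod_nonneg fun _ _ => sub_nonneg.2 (hq1 _))

variable [IsProbabilityMeasure μ] [Fintype α]

lemma le_measureReal_branching (hm : ∀ l, m l ≤ mΩ) (hind : iIndep m μ)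
    (hA : ∀ l s, MeasurableSet[m l] (A l s)) {n : ℕ} {M c : ℝ} (hM1 : 1 < M)
    (hM : ∀ l, M ≤ ∑ s : Fin n → α, μ.real (covered A l (List.ofFn s)))
    (hc0 : 0 < c) (hc1 : c ≤ 1) (hc : ((Fintype.card α : ℝ) ^ n) ^ 2 * c ≤ M ^ 2 - M) (k : ℕ)
    (l : List α) : c ≤ μ.real (branching A n k l) := by
  induction k generalizing l with
  | zero => simpa [branching] using hc1
  | succ k ih =>
    set S := ∑ s : Fin n → α, μ.real (covered A l (List.ofFn s))
    have hMS : M ≤ S := hM l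
    refine le_measureReal_iUnion_inter (c := c) (S := S)
      (fun s => sigmaOn_le hm _ _ (measurableSet_covered hA l _))
      (fun s => sigmaOn_le hm _ _ (measurableSet_branching hA n k _))
      (fun s => measureReal_covered_inter_branching hm hind hA n k l _)
      (fun s t hst => measureReal_branching_inter_branching hm hind hA n k (by simp) ?_)
      hc0 (fun s => ih _) (by linarith) rfl ?_
    · exact fun h => hst (List.ofFn_injective (List.append_cancel_right h))
    · rw [Fintype.card_fun, Fintype.card_fin, Nat.cast_pow]
      nlinarith only [hc, mul_nonneg (sub_nonneg.2 hMS) (by linarith : 0 ≤ S + M - 1)]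

lemma exists_forall_le_measureReal_branching (hm : ∀ l, m l ≤ mΩ) (hind : iIndep m μ)
    (hA : ∀ l s, MeasurableSet[m l] (A l s)) (hP : ∀ l s, μ.real (A l s) = q s.length)
    (hq : 0 < q 1) (hmono : ∀ l s t, A l (t ++ s) ⊆ A l s) {N : ℕ}
    (hN : 1 < ∑ i ∈ Finset.range N, (Fintype.card α : ℝ) ^ (i + 1) * lastHit q i) :
    ∃ n ≠ 0, ∃ c > 0, ∀ k l, c ≤ μ.real (branching A n k l) := by
  set D : ℝ := (Fintype.card α : ℝ)
  have hD0 : 0 < D := by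
    refine (Nat.cast_nonneg _).lt_of_ne fun h => ?_
    simp only [D, ← h, zero_pow (Nat.succ_ne_zero _), zero_mul, Finset.sum_const_zero] at hN
    exact absurd hN (by norm_num)
  obtain ⟨a⟩ : Nonempty α := Fintype.card_pos_iff.1 (Nat.cast_pos.1 hD0)
  have hqk (k : ℕ) : q k = μ.real (A [] (List.replicate k a)) := by rw [hP, List.length_replicate]
  have hlast (i : ℕ) : 0 ≤ D ^ (i + 1) * lastHit q i :=
    mul_nonneg (by positivity) (lastHit_nonneg (fun k => by rw [hqk]; exact measureReal_nonneg)
      (fun k => by rw [hqk]; exact measureReal_le_one) i)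
  have hlast0 : 0 < D ^ (0 + 1) * lastHit q 0 := by
    simpa [lastHit] using mul_pos hD0 hq
  obtain ⟨n, hn, hn0⟩ := (((tendsto_renewal_atTop hlast hlast0 hN).eventually_gt_atTop 1).and
    (Filter.eventually_ne_atTop 0)).exists
  rw [renewal_pow_mul] at hn
  set M := D ^ n * renewal (lastHit q) n
  have hM (l : List α) : M ≤ ∑ s : Fin n → α, μ.real (covered A l (List.ofFn s)) := by
    calc M = ∑ s : Fin n → α, renewal (lastHit q) (List.ofFn s).length := by simp [M, D]
      _ ≤ ∑ s : Fin n → α, μ.real (covered A l (List.ofFn s)) :=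
        Finset.sum_le_sum fun s _ => renewal_le_measureReal_covered hm hind hA hP hmono l _
  have hMM : 0 < M ^ 2 - M := by nlinarith only [hn]
  have hc0 : 0 < min 1 ((M ^ 2 - M) / (D ^ n) ^ 2) := lt_min one_pos (by positivity)
  refine ⟨n, hn0, _, hc0, le_measureReal_branching hm hind hA hn hM hc0 (min_le_left _ _) ?_⟩
  rw [← le_div_iff₀' (by positivity)]
  exact min_le_right _ _

theorem exists_measure_pos_of_one_lt (hm : ∀ l, m l ≤ mΩ) (hind : iIndep m μ)
    (hA : ∀ l s, MeasurableSet[m l] (A l s)) (hP : ∀ l s, μ.real (A l s) = q s.length)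
    (hq : 0 < q 1) (hmono : ∀ l s t, A l (t ++ s) ⊆ A l s) {N : ℕ}
    (hN : 1 < ∑ i ∈ Finset.range N, (Fintype.card α : ℝ) ^ (i + 1) * lastHit q i) :
    ∃ S : Set Ω, 0 < μ S ∧ ∀ ω ∈ S, ∀ R : List α → Prop, R [] →
      (∀ l s, R l → ω ∈ A l s → R (s ++ l)) → ∀ k, ∃ s, R s ∧ k ≤ s.length := by
  obtain ⟨n, hn, c, hc, hB⟩ := exists_forall_le_measureReal_branching hm hind hA hP hq hmono hN
  refine ⟨⋂ k, branching A n k [], ?_, fun ω hω R hR0 hR k => ?_⟩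
  · have hlim := tendsto_measure_iInter_atTop (μ := μ)
      (fun k => (sigmaOn_le hm _ _ (measurableSet_branching hA n k [])).nullMeasurableSet)
      (antitone_branching n _) ⟨0, measure_ne_top _ _⟩
    refine (ENNReal.ofReal_pos.2 hc).trans_le (ge_of_tendsto' hlim fun k => ?_)
    exact ENNReal.ofReal_le_of_le_toReal (hB k [])
  · obtain ⟨s, hs, hlen⟩ := exists_length_eq_of_mem_branching hR hR0 (Set.mem_iInter.1 hω k)
    refine ⟨s, hs, ?_⟩
    rw [hlen]
    exact (Nat.le_mul_of_pos_right k (Nat.pos_of_ne_zero hn)).trans (Nat.le_add_right _ _)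

end Branching

section Tree

variable {V : Type*} {G : SimpleGraph V}

lemma mem_support_of_dist_add_dist (hG : G.IsTree) {x y z : V}
    (h : G.dist x y + G.dist y z = G.dist x z) (p : G.Walk x z) : y ∈ p.support := by
  classical
  obtain ⟨q, hq⟩ := hG.connected.exists_walk_length_eq_dist x y
  obtain ⟨r, hr⟩ := hG.connected.exists_walk_length_eq_dist y z
  have hqr : (q.append r).IsPath :=
    SimpleGraph.Walk.isPath_of_length_eq_dist _ (by rw [SimpleGraph.Walk.length_append, hq, hr, h])
  have heq : q.append r = p.bypass := congrArg Subtype.val <|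
    (hG.isAcyclic.subsingleton_path x z).elim ⟨q.append r, hqr⟩ ⟨p.bypass, p.bypass_isPath⟩
  refine p.support_bypass_subset_support ?_
  rw [← heq, SimpleGraph.Walk.mem_support_append_iff]
  exact Or.inl q.end_mem_support

lemma eq_of_adj_of_dist_add_one (hG : G.IsTree) {o u u' v : V} (h : G.Adj u v) (h' : G.Adj u' v)
    (hu : G.dist o u + 1 = G.dist o v) (hu' : G.dist o u' + 1 = G.dist o v) : u = u' := by
  classical
  obtain ⟨q, hq⟩ := hG.connected.exists_walk_length_eq_dist o u
  have hmem : u' ∈ (q.concat h).support :=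
    mem_support_of_dist_add_dist hG (by rw [SimpleGraph.dist_eq_one_iff_adj.2 h', hu']) _
  rw [SimpleGraph.Walk.support_concat, List.mem_append, List.mem_singleton] at hmem
  rcases hmem with hmem | rfl
  · by_contra hne
    have hlt := q.length_takeUntil_lt_length hmem (Ne.symm hne)
    have hle := SimpleGraph.dist_le (q.takeUntil u' hmem)
    omega
  · exact absurd h' (G.loopless.irrefl _)

lemma exists_adj_dist_add_one_eq (hG : G.Connected) {w x : V} (h : x ≠ w) :
    ∃ y, G.Adj x y ∧ G.dist w y + 1 = G.dist w x := by
  obtain ⟨q, hq⟩ := hG.exists_walk_length_eq_dist w x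
  have hnil : ¬ q.Nil := SimpleGraph.Walk.not_nil_of_ne h.symm
  have hpos := SimpleGraph.Walk.not_nil_iff_lt_length.1 hnil
  have hle := SimpleGraph.dist_le q.dropLast
  have hge := hG.dist_triangle (u := w) (v := q.penultimate) (w := x)
  rw [SimpleGraph.Walk.length_dropLast] at hle
  rw [SimpleGraph.dist_eq_one_iff_adj.2 (q.adj_penultimate hnil)] at hge
  exact ⟨q.penultimate, (q.adj_penultimate hnil).symm, by omega⟩

lemma finite_setOf_dist_le [G.LocallyFinite] (hG : G.Connected) (o : V) (n : ℕ) :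
    {v | G.dist o v ≤ n}.Finite := by
  induction n with
  | zero =>
    refine (Set.finite_singleton o).subset fun v hv => ?_
    exact (hG.dist_eq_zero_iff.1 (Nat.le_zero.1 hv)).symm
  | succ n ih =>
    refine (ih.union (ih.biUnion fun v _ => (G.neighborSet v).toFinite)).subset fun v hv => ?_
    rcases eq_or_ne v o with rfl | hne
    · exact Or.inl (by simp)
    · obtain ⟨y, hy, hdist⟩ := exists_adj_dist_add_one_eq hG hne
      exact Or.inr (Set.mem_biUnion (x := y) (Nat.le_of_succ_le_succ (hdist.trans_le hv)) hy.symm)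

lemma countable_of_locallyFinite [G.LocallyFinite] (hG : G.Connected) : Countable V := by
  obtain ⟨o⟩ := hG.nonempty
  have hcover : (⋃ n : ℕ, {v | G.dist o v ≤ n}) = Set.univ :=
    Set.eq_univ_of_forall fun v => Set.mem_iUnion.2 ⟨_, le_refl (G.dist o v)⟩
  rw [← Set.countable_univ_iff, ← hcover]
  exact Set.countable_iUnion fun n => (finite_setOf_dist_le hG o n).countable

lemma exists_unique_closer (hG : G.IsTree) {x w : V} (h : x ≠ w) :
    ∃ y, G.Adj x y ∧ G.dist w y + 1 = G.dist w x ∧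
      ∀ z, G.Adj x z → z ≠ y → G.dist w z = G.dist w x + 1 := by
  obtain ⟨y, hy, hdist⟩ := exists_adj_dist_add_one_eq hG.connected h
  refine ⟨y, hy, hdist, fun z hz hne => ?_⟩
  rcases hG.dist_eq_dist_add_one_of_adj w hz with hcloser | hfarther
  · exact absurd (eq_of_adj_of_dist_add_one hG hz.symm hy.symm hcloser.symm hdist) hne
  · exact hfarther

lemma sum_neighborFinset_dist [G.LocallyFinite] (hG : G.IsTree) {d : ℕ} {x w : V}
    (hx : G.degree x = d + 1) (h : x ≠ w) (f : ℕ → ℝ) :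
    ∑ y ∈ G.neighborFinset x, f (G.dist w y) =
      f (G.dist w x - 1) + d * f (G.dist w x + 1) := by
  classical
  obtain ⟨y, hy, hdist, hfar⟩ := exists_unique_closer hG h
  have hmem : y ∈ G.neighborFinset x := (G.mem_neighborFinset x y).2 hy
  have herase : ∀ z ∈ (G.neighborFinset x).erase y, f (G.dist w z) = f (G.dist w x + 1) := by
    intro z hz
    rw [Finset.mem_erase, SimpleGraph.mem_neighborFinset] at hz
    rw [hfar z hz.2 hz.1]
  rw [← Finset.add_sum_erase _ _ hmem, Finset.sum_congr rfl herase, Finset.sum_const,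
    Finset.card_erase_of_mem hmem, SimpleGraph.card_neighborFinset_eq_degree, hx,
    Nat.add_sub_cancel, nsmul_eq_mul, ← hdist, Nat.add_sub_cancel]

lemma degree_le_card_farther_add_one [G.LocallyFinite] (hG : G.IsTree) (o v : V) :
    G.degree v ≤ Finset.card {y ∈ G.neighborFinset v | G.dist o y = G.dist o v + 1} + 1 := by
  classical
  rw [← SimpleGraph.card_neighborFinset_eq_degree]
  rcases eq_or_ne v o with rfl | hne
  · refine (Finset.card_le_card fun y hy => ?_).trans (Nat.le_succ _)
    have hadj := (G.mem_neighborFinset v y).1 hy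
    exact Finset.mem_filter.2 ⟨hy, by simp [SimpleGraph.dist_eq_one_iff_adj.2 hadj]⟩
  · obtain ⟨y, -, -, hfar⟩ := exists_unique_closer hG hne
    refine (Finset.card_le_card fun z hz => ?_).trans (Finset.card_insert_le y _)
    rw [Finset.mem_insert, Finset.mem_filter, or_iff_not_imp_left]
    exact fun hzy => ⟨hz, hfar z ((G.mem_neighborFinset v z).1 hz) hzy⟩

lemma exists_children [G.LocallyFinite] (hG : G.IsTree) {d : ℕ} (o : V) {v : V}
    (hv : d + 1 ≤ G.degree v) :
    ∃ c : Fin d → V, Function.Injective c ∧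
      ∀ a, G.Adj v (c a) ∧ G.dist o (c a) = G.dist o v + 1 := by
  classical
  obtain ⟨e⟩ : Nonempty (Fin d ↪ {y ∈ G.neighborFinset v | G.dist o y = G.dist o v + 1}) := by
    refine Function.Embedding.nonempty_of_card_le ?_
    rw [Fintype.card_fin, Fintype.card_coe]
    exact Nat.le_of_succ_le_succ (hv.trans (degree_le_card_farther_add_one hG o v))
  refine ⟨fun a => e a, Subtype.val_injective.comp e.injective, fun a => ?_⟩
  have hmem := (e a).2
  rwa [Finset.mem_filter, SimpleGraph.mem_neighborFinset] at hmem

section Descendant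

variable {α : Type*} {c : V → α → V} {o : V}

/-- The vertex reached from `o` by reading a word from its last letter, the letter `a` leading from
`v` to its child `c v a`. -/
def descendant (c : V → α → V) (o : V) : List α → V
  | [] => o
  | a :: l => c (descendant c o l) a

lemma dist_root_descendant (hc : ∀ v a, G.dist o (c v a) = G.dist o v + 1) (l : List α) :
    G.dist o (descendant c o l) = l.length := by
  induction l with
  | nil => exact SimpleGraph.dist_self
  | cons a l ih => rw [descendant, hc, ih, List.length_cons]

lemma dist_descendant_append (hG : G.Connected)
    (hc : ∀ v a, G.Adj v (c v a) ∧ G.dist o (c v a) = G.dist o v + 1) (l s : List α) :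
    G.dist (descendant c o l) (descendant c o (s ++ l)) = s.length := by
  apply le_antisymm
  · induction s with
    | nil => simp
    | cons a s ih =>
      have hadj := SimpleGraph.dist_eq_one_iff_adj.2 (hc (descendant c o (s ++ l)) a).1
      have htri := hG.dist_triangle (u := descendant c o l) (v := descendant c o (s ++ l))
        (w := descendant c o (a :: s ++ l))
      exact htri.trans (Nat.add_le_add ih hadj.le)
  · have htri := hG.dist_triangle (u := o) (v := descendant c o l) (w := descendant c o (s ++ l))
    rw [dist_root_descendant fun v a => (hc v a).2, dist_root_descendant fun v a => (hc v a).2,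
      List.length_append] at htri
    omega

lemma injective_descendant (hG : G.IsTree) (hinj : ∀ v, Function.Injective (c v))
    (hc : ∀ v a, G.Adj v (c v a) ∧ G.dist o (c v a) = G.dist o v + 1) :
    Function.Injective (descendant c o) := by
  have hlen {l l' : List α} (h : descendant c o l = descendant c o l') : l.length = l'.length := by
    rw [← dist_root_descendant fun v a => (hc v a).2, h, dist_root_descendant fun v a => (hc v a).2]
  intro l l' h
  induction l generalizing l' with
  | nil => exact (List.eq_nil_of_length_eq_zero (hlen h).symm).symm
  | cons a l ih =>
    obtain ⟨a', l', rfl⟩ := List.exists_cons_of_length_eq_add_one (hlen h).symm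
    have h' : c (descendant c o l) a = c (descendant c o l') a' := h
    have hparent : descendant c o l = descendant c o l' :=
      eq_of_adj_of_dist_add_one hG (hc _ a).1 (h' ▸ (hc _ a').1) (hc _ a).2.symm
        (h' ▸ (hc _ a').2.symm)
    rw [← hparent] at h'
    rw [hinj _ h', ih hparent]

end Descendant

lemma exists_word_embedding [G.LocallyFinite] (hG : G.IsTree) {d : ℕ}
    (hdeg : ∀ v, d + 1 ≤ G.degree v) (o : V) :
    ∃ f : List (Fin d) → V, f [] = o ∧ Function.Injective f ∧
      ∀ l s, G.dist (f l) (f (s ++ l)) = s.length := by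
  choose c hinj hc using fun v => exists_children hG o (hdeg v)
  exact ⟨descendant c o, rfl, injective_descendant hG hinj hc,
    dist_descendant_append hG.connected hc⟩

end Tree

section Walk

lemma measurePreserving_head_tail {X : Type*} [MeasurableSpace X] (κ : Measure X)
    [IsProbabilityMeasure κ] :
    MeasurePreserving (fun φ : ℕ → X => (φ 0, fun n => φ (n + 1)))
      (Measure.infinitePi fun _ => κ) (κ.prod (Measure.infinitePi fun _ => κ)) := by
  have hhead : Measurable fun φ : ℕ → X => φ 0 := measurable_pi_apply 0
  have htail : Measurable fun (φ : ℕ → X) n => φ (n + 1) :=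
    measurable_pi_lambda _ fun n => measurable_pi_apply (n + 1)
  have hindep : IndepFun (fun φ : ℕ → X => φ 0) (fun (φ : ℕ → X) n => φ (n + 1))
      (Measure.infinitePi fun _ => κ) := by
    let m (n : ℕ) : MeasurableSpace (ℕ → X) := MeasurableSpace.comap (fun φ => φ n) inferInstance
    have hsplit : Indep (sigmaOn m {0}) (sigmaOn m {0}ᶜ) (Measure.infinitePi fun _ => κ) :=
      indep_iSup_of_disjoint (fun n => (measurable_pi_apply n).comap_le)
        (iIndepFun_infinitePi (X := fun _ x => x) fun _ => measurable_id) disjoint_compl_right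
    have htail_le : MeasurableSpace.comap (fun (φ : ℕ → X) n => φ (n + 1)) inferInstance ≤
        sigmaOn m {0}ᶜ := by
      rw [MeasurableSpace.pi, MeasurableSpace.comap_iSup]
      refine iSup_le fun n => ?_
      rw [MeasurableSpace.comap_comp]
      exact le_sigmaOn (m := m) (i := n + 1) n.succ_ne_zero
    exact (IndepFun_iff_Indep _ _ _).2 <| indep_of_indep_of_le_left
      (indep_of_indep_of_le_right hsplit htail_le) (le_sigmaOn (m := m) (Set.mem_singleton 0))
  refine ⟨hhead.prodMk htail, ?_⟩
  rw [hindep.map_prod_eq_prod_map_map hhead.aemeasurable htail.aemeasurable,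
    Measure.infinitePi_map_eval, Measure.map_infinitePi_infinitePi_of_inj Nat.succ_injective]

lemma walk_succ_eq_walk_tail {V : Type*} (φ : ℕ → V → V) (v : V) (n : ℕ) :
    walk φ v (n + 1) = walk (fun i => φ (i + 1)) (φ 0 v) n := by
  induction n with
  | zero => rfl
  | succ n ih => rw [walk, ih]; rfl

variable {V : Type*}

/-- The event that the walk started at `x` visits `w` within `k` steps. -/
def visitsWithin (w : V) (k : ℕ) (x : V) : Set (ℕ → V → V) := {φ | ∃ n ≤ k, walk φ x n = w}

lemma visitsWithin_self (w : V) (k : ℕ) : visitsWithin w k w = Set.univ :=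
  Set.eq_univ_of_forall fun _ => ⟨0, Nat.zero_le _, rfl⟩

lemma visitsWithin_zero_of_ne {w x : V} (h : x ≠ w) : visitsWithin w 0 x = ∅ := by
  refine Set.eq_empty_of_forall_notMem ?_
  rintro φ ⟨n, hn, hw⟩
  rw [Nat.le_zero.1 hn] at hw
  exact h hw

lemma mem_visitsWithin_succ {w x : V} (h : x ≠ w) {k : ℕ} {φ : ℕ → V → V} :
    φ ∈ visitsWithin w (k + 1) x ↔ (fun n => φ (n + 1)) ∈ visitsWithin w k (φ 0 x) := by
  constructor
  · rintro ⟨n, hn, hw⟩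
    cases n with
    | zero => exact absurd hw h
    | succ n => exact ⟨n, Nat.le_of_succ_le_succ hn, by rwa [walk_succ_eq_walk_tail] at hw⟩
  · rintro ⟨n, hn, hw⟩
    exact ⟨n + 1, Nat.succ_le_succ hn, by rwa [walk_succ_eq_walk_tail]⟩

variable [MeasurableSpace V] [DiscreteMeasurableSpace V] [Countable V]

lemma measurable_walk (x : V) (n : ℕ) : Measurable fun φ : ℕ → V → V => walk φ x n := by
  induction n with
  | zero => exact measurable_const
  | succ n ih =>
    refine measurable_to_countable' fun v => ?_
    have hstep : (fun φ : ℕ → V → V => walk φ x (n + 1)) ⁻¹' {v} =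
        ⋃ u, (fun φ => walk φ x n) ⁻¹' {u} ∩ (fun φ => φ n u) ⁻¹' {v} := by
      ext φ
      simp [walk]
    rw [hstep]
    exact MeasurableSet.iUnion fun u => (ih (MeasurableSet.singleton u)).inter
      (((measurable_pi_apply u).comp (measurable_pi_apply n)) (MeasurableSet.singleton v))

lemma measurableSet_visitsWithin (w : V) (k : ℕ) (x : V) :
    MeasurableSet (visitsWithin w k x) := by
  have hunion : visitsWithin w k x = ⋃ n ∈ Set.Iic k, (fun φ => walk φ x n) ⁻¹' {w} := by
    ext φ
    simp [visitsWithin]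
  rw [hunion]
  exact MeasurableSet.biUnion (Set.to_countable _) fun n _ =>
    measurable_walk x n (MeasurableSet.singleton w)

lemma measurableSet_setOf_mem_visitsWithin (w : V) (k : ℕ) (x : V) :
    MeasurableSet {q : (V → V) × (ℕ → V → V) | q.2 ∈ visitsWithin w k (q.1 x)} := by
  have hunion : {q : (V → V) × (ℕ → V → V) | q.2 ∈ visitsWithin w k (q.1 x)} =
      ⋃ y, {ψ | ψ x = y} ×ˢ visitsWithin w k y := by
    ext q
    simp
  rw [hunion]
  exact MeasurableSet.iUnion fun y => MeasurableSet.prod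
    (measurableSet_eq_fun (measurable_pi_apply x) measurable_const)
    (measurableSet_visitsWithin w k y)

end Walk

section MoveLaw

variable {V : Type*} {G : SimpleGraph V} [G.LocallyFinite]

lemma neighborSet_nonempty {x : V} (hx : G.degree x ≠ 0) : (G.neighborSet x).Nonempty := by
  rw [← G.coe_neighborFinset, Finset.coe_nonempty, ← Finset.card_pos]
  exact Nat.pos_of_ne_zero hx

variable [MeasurableSpace V] [DiscreteMeasurableSpace V]

lemma lintegral_uniformOn_neighborSet (x : V) (f : V → ℝ≥0∞) :
    ∫⁻ y, f y ∂(uniformOn (G.neighborSet x)) =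
      (G.degree x : ℝ≥0∞)⁻¹ * ∑ y ∈ G.neighborFinset x, f y := by
  rw [uniformOn, ProbabilityTheory.cond, lintegral_smul_measure, ← G.coe_neighborFinset,
    lintegral_finset, Measure.count_apply_finset, G.card_neighborFinset_eq_degree, smul_eq_mul]
  simp only [Measure.count_singleton, mul_one]

lemma isProbabilityMeasure_uniformOn_neighborSet {x : V} (hx : G.degree x ≠ 0) :
    IsProbabilityMeasure (uniformOn (G.neighborSet x)) :=
  isProbabilityMeasure_uniformOn (G.neighborSet x).toFinite (neighborSet_nonempty hx)

/-- The law of one map `φₙ` driving the simple random walk on `G`: each vertex independently chooses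
one of its neighbours uniformly. -/
noncomputable def stepLaw (G : SimpleGraph V) : Measure (V → V) :=
  Measure.infinitePi fun x => uniformOn (G.neighborSet x)

/-- The law of the sequence of maps driving the simple random walk on `G`. -/
noncomputable def moveLaw (G : SimpleGraph V) : Measure (ℕ → V → V) :=
  Measure.infinitePi fun _ => stepLaw G

lemma isProbabilityMeasure_stepLaw (hG : ∀ x, G.degree x ≠ 0) :
    IsProbabilityMeasure (stepLaw G) := by
  have (x : V) := isProbabilityMeasure_uniformOn_neighborSet (hG x)
  unfold stepLaw
  infer_instance

lemma isProbabilityMeasure_moveLaw (hG : ∀ x, G.degree x ≠ 0) :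
    IsProbabilityMeasure (moveLaw G) := by
  have := isProbabilityMeasure_stepLaw hG
  unfold moveLaw
  infer_instance

lemma measurePreserving_eval_stepLaw (hG : ∀ x, G.degree x ≠ 0) (x : V) :
    MeasurePreserving (Function.eval x) (stepLaw G) (uniformOn (G.neighborSet x)) := by
  have (x : V) := isProbabilityMeasure_uniformOn_neighborSet (hG x)
  exact measurePreserving_eval_infinitePi _ x

lemma ae_moveLaw_adj [Countable V] (hG : ∀ x, G.degree x ≠ 0) :
    ∀ᵐ φ ∂(moveLaw G), ∀ n x, G.Adj x (φ n x) := by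
  have := isProbabilityMeasure_stepLaw hG
  refine ae_all_iff.2 fun n => ae_all_iff.2 fun x => ?_
  have := isProbabilityMeasure_uniformOn_neighborSet (hG x)
  have hadj : ∀ᵐ y ∂(uniformOn (G.neighborSet x)), G.Adj x y :=
    (prob_compl_eq_zero_iff .of_discrete).2
      (uniformOn_self (G.neighborSet x).toFinite (neighborSet_nonempty (hG x)))
  exact ((measurePreserving_eval_stepLaw hG x).comp
    (measurePreserving_eval_infinitePi (fun _ => stepLaw G) n)).quasiMeasurePreserving.ae hadj

lemma measure_visitsWithin_succ [Countable V] (hG : ∀ x, G.degree x ≠ 0) {w x : V} (hx : x ≠ w)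
    (k : ℕ) : moveLaw G (visitsWithin w (k + 1) x) =
      (G.degree x : ℝ≥0∞)⁻¹ * ∑ y ∈ G.neighborFinset x, moveLaw G (visitsWithin w k y) := by
  have := isProbabilityMeasure_stepLaw hG
  have := isProbabilityMeasure_moveLaw hG
  have hpreim : visitsWithin w (k + 1) x = (fun φ : ℕ → V → V => (φ 0, fun n => φ (n + 1))) ⁻¹'
      {q | q.2 ∈ visitsWithin w k (q.1 x)} := Set.ext fun _ => mem_visitsWithin_succ hx
  have hmeas := measurableSet_setOf_mem_visitsWithin w k x
  calc moveLaw G (visitsWithin w (k + 1) x)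
      = ((stepLaw G).prod (moveLaw G)) {q | q.2 ∈ visitsWithin w k (q.1 x)} := by
        rw [hpreim]
        exact (measurePreserving_head_tail (stepLaw G)).measure_preimage hmeas.nullMeasurableSet
    _ = ∫⁻ ψ, moveLaw G (visitsWithin w k (ψ x)) ∂(stepLaw G) := Measure.prod_apply hmeas
    _ = ∫⁻ y, moveLaw G (visitsWithin w k y) ∂(uniformOn (G.neighborSet x)) :=
        (measurePreserving_eval_stepLaw hG x).lintegral_comp
          (f := fun y => moveLaw G (visitsWithin w k y)) .of_discrete
    _ = _ := lintegral_uniformOn_neighborSet x _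

end MoveLaw

section KilledHarmonic

variable {V : Type*} {G : SimpleGraph V} [G.LocallyFinite] {p : ℝ} {w : V} {H K : V → ℝ}

/-- The equations satisfied by the probability `H x` that a simple random walk started at `x`, which
makes each further jump with probability `p`, visits `w`. -/
structure IsKilledHarmonic (G : SimpleGraph V) [G.LocallyFinite] (p : ℝ) (w : V) (H : V → ℝ) :
    Prop where
  eq_one : H w = 1
  eq_average : ∀ x, x ≠ w → H x = p * ((G.degree x : ℝ)⁻¹ * ∑ y ∈ G.neighborFinset x, H y)

lemma abs_average_le {f : V → ℝ} {c : ℝ} (hf : ∀ y, |f y| ≤ c) (x : V) :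
    |(G.degree x : ℝ)⁻¹ * ∑ y ∈ G.neighborFinset x, f y| ≤ c := by
  have hsum : |∑ y ∈ G.neighborFinset x, f y| ≤ G.degree x * c := by
    refine (Finset.abs_sum_le_sum_abs _ _).trans ((Finset.sum_le_sum fun y _ => hf y).trans_eq ?_)
    rw [Finset.sum_const, G.card_neighborFinset_eq_degree, nsmul_eq_mul]
  calc |(G.degree x : ℝ)⁻¹ * ∑ y ∈ G.neighborFinset x, f y|
      ≤ (G.degree x : ℝ)⁻¹ * (G.degree x * c) := by
        rw [abs_mul, abs_of_nonneg (by positivity : (0 : ℝ) ≤ (G.degree x : ℝ)⁻¹)]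
        gcongr
    _ ≤ c := by
        rw [← mul_assoc]
        exact mul_le_of_le_one_left ((abs_nonneg _).trans (hf x)) inv_mul_le_one

lemma IsKilledHarmonic.abs_sub_le_pow_mul (hH : IsKilledHarmonic G p w H)
    (hK : IsKilledHarmonic G p w K) (hp0 : 0 ≤ p) {C : ℝ} (hC : ∀ x, |H x - K x| ≤ C) (n : ℕ)
    (x : V) : |H x - K x| ≤ p ^ n * C := by
  induction n generalizing x with
  | zero => simpa using hC x
  | succ n ih =>
    rcases eq_or_ne x w with rfl | hx
    · rw [hH.eq_one, hK.eq_one, sub_self, abs_zero]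
      exact mul_nonneg (pow_nonneg hp0 _) ((abs_nonneg _).trans (hC x))
    · rw [hH.eq_average x hx, hK.eq_average x hx, ← mul_sub, ← mul_sub, ← Finset.sum_sub_distrib,
        abs_mul, abs_of_nonneg hp0, pow_succ', mul_assoc]
      exact mul_le_mul_of_nonneg_left (abs_average_le ih x) hp0

lemma IsKilledHarmonic.eq_of_bounded (hH : IsKilledHarmonic G p w H)
    (hK : IsKilledHarmonic G p w K) (hp0 : 0 ≤ p) (hp1 : p < 1) {C : ℝ}
    (hC : ∀ x, |H x - K x| ≤ C) : H = K := by
  ext x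
  have hlim : Filter.Tendsto (fun n => p ^ n * C) Filter.atTop (nhds 0) := by
    simpa using (tendsto_pow_atTop_nhds_zero_of_lt_one hp0 hp1).mul_const C
  have hle := ge_of_tendsto' hlim fun n => hH.abs_sub_le_pow_mul hK hp0 hC n x
  exact sub_eq_zero.1 (abs_nonpos_iff.1 hle)

lemma isKilledHarmonic_pow_dist (hG : G.IsTree) {d : ℕ} (hreg : G.IsRegularOfDegree (d + 1)) {b : ℝ}
    (hpb : p * (1 + d * b ^ 2) = (d + 1) * b) (w : V) :
    IsKilledHarmonic G p w fun x => b ^ G.dist w x where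
  eq_one := by simp
  eq_average x hx := by
    obtain ⟨k, hk⟩ : ∃ k, G.dist w x = k + 1 :=
      Nat.exists_eq_succ_of_ne_zero (hG.connected.pos_dist_of_ne hx.symm).ne'
    rw [sum_neighborFinset_dist hG (hreg x) hx fun k => b ^ k, hreg x, hk, Nat.add_sub_cancel,
      Nat.cast_succ]
    have hd : (d : ℝ) + 1 ≠ 0 := by positivity
    field_simp
    rw [pow_succ, pow_add b k 2]
    linear_combination (-b ^ k) * hpb

end KilledHarmonic

section ParticleLaw

variable {V : Type*} {G : SimpleGraph V}

/-- The set of the particles which, started at `x`, move along the edges of `G` and visit `w`. The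
former condition holds almost surely; with it, a visit to `w` entails a visit to every vertex
between `x` and `w` on a tree, without exceptional null sets. -/
def visits (G : SimpleGraph V) (x w : V) : Set (Particle V) :=
  {π | (∀ n u, G.Adj u (π.moves n u)) ∧ ∃ n ≤ π.lifetime, walk π.moves x n = w}

lemma exists_walk_forall_mem_support {φ : ℕ → V → V} (hφ : ∀ n u, G.Adj u (φ n u)) (x : V) (n : ℕ) :
    ∃ q : G.Walk x (walk φ x n), ∀ u ∈ q.support, ∃ k ≤ n, walk φ x k = u := by
  induction n with
  | zero =>
    exact ⟨SimpleGraph.Walk.nil, fun u hu =>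
      ⟨0, le_rfl, (SimpleGraph.Walk.mem_support_nil_iff.1 hu).symm⟩⟩
  | succ n ih =>
    obtain ⟨q, hq⟩ := ih
    refine ⟨q.concat (hφ n _), fun u hu => ?_⟩
    have hu := List.mem_append.1 (q.support_concat (hφ n _) ▸ hu)
    rcases hu.imp_right List.mem_singleton.1 with hu | rfl
    · obtain ⟨k, hk, hwalk⟩ := hq u hu
      exact ⟨k, hk.trans n.le_succ, hwalk⟩
    · exact ⟨n + 1, le_rfl, rfl⟩

lemma visits_subset_of_dist_add_dist (hG : G.IsTree) {x y z : V}
    (h : G.dist x y + G.dist y z = G.dist x z) : visits G x z ⊆ visits G x y := by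
  rintro π ⟨hadj, n, hn, rfl⟩
  obtain ⟨q, hq⟩ := exists_walk_forall_mem_support hadj x n
  obtain ⟨k, hk, hy⟩ := hq y (mem_support_of_dist_add_dist hG h q)
  exact ⟨hadj, k, hk.trans hn, hy⟩

lemma measurableSet_visits [Countable V] (x w : V) : MeasurableSet (visits G x w) := by
  let _ : MeasurableSpace V := ⊤
  have hmoves : Measurable (Particle.moves : Particle V → ℕ → V → V) := measurable_fst
  have hlife : Measurable (Particle.lifetime : Particle V → ℕ) := measurable_snd
  have hvisits : visits G x w = (⋂ n, ⋂ u, Particle.moves ⁻¹' {φ | G.Adj u (φ n u)}) ∩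
      ⋃ n, Particle.lifetime ⁻¹' Set.Ici n ∩ Particle.moves ⁻¹' {φ | walk φ x n = w} := by
    ext π
    simp [visits]
  rw [hvisits]
  refine MeasurableSet.inter
    (MeasurableSet.iInter fun n => MeasurableSet.iInter fun u => hmoves ?_)
    (MeasurableSet.iUnion fun n => (hlife .of_discrete).inter (hmoves ?_))
  · exact ((measurable_pi_apply u).comp (measurable_pi_apply n))
      (MeasurableSet.of_discrete (s := {y | G.Adj u y}))
  · exact measurable_walk x n (MeasurableSet.singleton w)

/-- The probability that the simple random walk on `G` started at `x` visits `w` within `k`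
steps. -/
noncomputable def visitProb (G : SimpleGraph V) (w : V) (k : ℕ) (x : V) : ℝ :=
  letI : MeasurableSpace V := ⊤
  (moveLaw G).real (visitsWithin w k x)

lemma visitProb_nonneg (G : SimpleGraph V) (w : V) (k : ℕ) (x : V) : 0 ≤ visitProb G w k x :=
  measureReal_nonneg

lemma visitProb_zero_of_ne {w x : V} (h : x ≠ w) : visitProb G w 0 x = 0 := by
  rw [visitProb, visitsWithin_zero_of_ne h, measureReal_empty]

variable [G.LocallyFinite] {p : unitInterval}

lemma visitProb_self (hG : ∀ x, G.degree x ≠ 0) (w : V) (k : ℕ) : visitProb G w k w = 1 := by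
  let _ : MeasurableSpace V := ⊤
  have := isProbabilityMeasure_moveLaw hG
  rw [visitProb, visitsWithin_self, probReal_univ]

lemma visitProb_succ [Countable V] (hG : ∀ x, G.degree x ≠ 0) {w x : V} (hx : x ≠ w) (k : ℕ) :
    visitProb G w (k + 1) x =
      (G.degree x : ℝ)⁻¹ * ∑ y ∈ G.neighborFinset x, visitProb G w k y := by
  let _ : MeasurableSpace V := ⊤
  have := isProbabilityMeasure_moveLaw hG
  simp only [visitProb, Measure.real]
  rw [measure_visitsWithin_succ hG hx, ENNReal.toReal_mul,
    ENNReal.toReal_sum fun _ _ => measure_ne_top _ _, ENNReal.toReal_inv, ENNReal.toReal_natCast]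

lemma isProbabilityMeasure_particleLaw (hG : ∀ x, G.degree x ≠ 0) :
    IsProbabilityMeasure (particleLaw G p) := by
  let _ : MeasurableSpace V := ⊤
  have := isProbabilityMeasure_moveLaw hG
  exact inferInstanceAs (IsProbabilityMeasure
    ((moveLaw G).prod (geometricMeasure (unitInterval.symm p))))

lemma geometricMeasure_symm_singleton (hp1 : p < 1) (k : ℕ) :
    geometricMeasure (unitInterval.symm p) {k} = ENNReal.ofReal ((p : ℝ) ^ k * (1 - p)) := by
  have hsymm : unitInterval.symm p ≠ 0 := fun h => hp1.ne (by simpa using h)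
  rw [geometricMeasure_singleton hsymm]
  simp

lemma particleLaw_visits [Countable V] (hG : ∀ x, G.degree x ≠ 0) (x w : V) :
    particleLaw G p (visits G x w) = ∑' k, ENNReal.ofReal (visitProb G w k x) *
      geometricMeasure (unitInterval.symm p) {k} := by
  let _ : MeasurableSpace V := ⊤
  have := isProbabilityMeasure_moveLaw hG
  have hslice (k : ℕ) : moveLaw G {φ | ((φ, k) : Particle V) ∈ visits G x w} =
      ENNReal.ofReal (visitProb G w k x) := by
    rw [visitProb, ofReal_measureReal]
    refine measure_congr ?_
    filter_upwards [ae_moveLaw_adj hG] with φ hφ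
    exact propext ⟨fun h => h.2, fun h => ⟨hφ, h⟩⟩
  calc particleLaw G p (visits G x w)
      = ∫⁻ k, moveLaw G {φ | ((φ, k) : Particle V) ∈ visits G x w}
          ∂(geometricMeasure (unitInterval.symm p)) :=
        Measure.prod_apply_symm (μ := moveLaw G) (measurableSet_visits (G := G) x w)
    _ = _ := by simp only [lintegral_countable', hslice]

lemma hasSum_measureReal_visits [Countable V] (hG : ∀ x, G.degree x ≠ 0) (hp1 : p < 1) (x w : V) :
    HasSum (fun k => (p : ℝ) ^ k * (1 - p) * visitProb G w k x)
      ((particleLaw G p).real (visits G x w)) := by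
  have := isProbabilityMeasure_particleLaw (p := p) hG
  have hsum := particleLaw_visits (p := p) hG x w
  have hterm (k : ℕ) : (ENNReal.ofReal (visitProb G w k x) *
      geometricMeasure (unitInterval.symm p) {k}).toReal =
        (p : ℝ) ^ k * (1 - p) * visitProb G w k x := by
    rw [geometricMeasure_symm_singleton hp1, ENNReal.toReal_mul,
      ENNReal.toReal_ofReal (visitProb_nonneg G w k x), ENNReal.toReal_ofReal, mul_comm]
    exact mul_nonneg (pow_nonneg p.2.1 _) (sub_nonneg.2 p.2.2)
  have hfin := hsum ▸ measure_ne_top (particleLaw G p) (visits G x w)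
  have h := ENNReal.hasSum_toReal hfin
  simp only [hterm] at h
  rwa [Measure.real, hsum, ENNReal.tsum_toReal_eq fun k => ENNReal.ne_top_of_tsum_ne_top hfin k,
    tsum_congr hterm]

lemma isKilledHarmonic_measureReal_visits [Countable V] (hG : ∀ x, G.degree x ≠ 0) (hp1 : p < 1)
    (w : V) : IsKilledHarmonic G p w fun x => (particleLaw G p).real (visits G x w) where
  eq_one := by
    have hp1' : (0 : ℝ) < 1 - p := sub_pos.2 hp1
    have hgeom := (hasSum_geometric_of_lt_one p.2.1 hp1).mul_right (1 - (p : ℝ))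
    rw [inv_mul_cancel₀ hp1'.ne'] at hgeom
    refine (hasSum_measureReal_visits hG hp1 w w).unique ?_
    simpa only [visitProb_self hG, mul_one] using hgeom
  eq_average x hx := by
    have hx_sum := (hasSum_nat_add_iff' 1).2 (hasSum_measureReal_visits hG hp1 x w)
    simp only [Finset.sum_range_one, visitProb_zero_of_ne hx, mul_zero, sub_zero] at hx_sum
    have hsum := ((hasSum_sum (s := G.neighborFinset x) fun y _ =>
      hasSum_measureReal_visits hG hp1 y w).mul_left (G.degree x : ℝ)⁻¹).mul_left (p : ℝ)
    refine hx_sum.unique (hsum.congr_fun fun k => ?_)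
    rw [visitProb_succ hG hx, ← Finset.mul_sum]
    ring

lemma measureReal_visits_eq_pow_dist (hG : G.IsTree) {d : ℕ}
    (hreg : G.IsRegularOfDegree (d + 1)) (hp1 : p < 1) {b : ℝ} (hb0 : 0 ≤ b) (hb1 : b ≤ 1)
    (hpb : (p : ℝ) * (1 + d * b ^ 2) = (d + 1) * b) (x w : V) :
    (particleLaw G p).real (visits G x w) = b ^ G.dist w x := by
  have := countable_of_locallyFinite hG.connected
  have hdeg (x : V) : G.degree x ≠ 0 := (hreg x).trans_ne d.succ_ne_zero
  have := isProbabilityMeasure_particleLaw (p := p) hdeg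
  refine congrFun ((isKilledHarmonic_measureReal_visits hdeg hp1 w).eq_of_bounded
    (isKilledHarmonic_pow_dist hG hreg hpb w) p.2.1 hp1 (C := 1) fun x => ?_) x
  exact abs_sub_le_of_nonneg_of_le measureReal_nonneg measureReal_le_one (pow_nonneg hb0 _)
    (pow_le_one₀ hb0 hb1)

end ParticleLaw

section Reachability

variable {V : Type*} {o v w : V} {ω : V → Particle V} {s t : ℕ}

lemma eq_root_or_exists_lt_of_reaches (h : Reaches o ω v t) :
    v = o ∨ ∃ s < t, ∃ u, Reaches o ω u s ∧ v = walk (ω u).moves u (t - s) := by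
  induction h with
  | root => exact Or.inl rfl
  | @step u s n hu _ ih =>
    cases n with
    | zero => exact ih
    | succ n => exact Or.inr ⟨s, by omega, u, hu, by rw [Nat.add_sub_cancel_left]⟩

lemma finite_setOf_reaches (o : V) (ω : V → Particle V) (t : ℕ) : {v | Reaches o ω v t}.Finite := by
  induction t using Nat.strong_induction_on with
  | _ t ih =>
  refine ((Set.finite_singleton o).union ((Set.finite_Iio t).biUnion fun s hs =>
    (ih s hs).image fun u => walk (ω u).moves u (t - s))).subset fun v hv => ?_
  rcases eq_root_or_exists_lt_of_reaches hv with rfl | ⟨s, hs, u, hu, rfl⟩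
  · exact Or.inl rfl
  · exact Or.inr (Set.mem_biUnion hs (Set.mem_image_of_mem _ hu))

lemma exists_activatedAt_of_reaches (h : Reaches o ω v s) : ∃ t ≤ s, ActivatedAt o ω v t := by
  classical
  have hex : ∃ t, Reaches o ω v t := ⟨s, h⟩
  exact ⟨Nat.find hex, Nat.find_min' hex h, Nat.find_spec hex, fun _ => Nat.find_min' hex⟩

lemma exists_reaches_le_of_forall_not_activeAt (ht : ∀ v, ¬ActiveAt o ω v t)
    (h : Reaches o ω v s) : ∃ r ≤ t, Reaches o ω v r := by
  induction h with
  | root => exact ⟨0, Nat.zero_le _, Reaches.root⟩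
  | @step v _ n _ hn ih =>
    obtain ⟨r, hrt, hr⟩ := ih
    obtain ⟨a, har, ha⟩ := exists_activatedAt_of_reaches hr
    have hremoved : a + (ω v).lifetime < t :=
      not_le.1 fun hle => ht v ⟨a, ha, har.trans hrt, hle⟩
    exact ⟨a + n, by omega, Reaches.step ha.1 hn⟩

lemma survives_of_infinite (h : {v | ∃ s, Reaches o ω v s}.Infinite) : Survives o ω := by
  intro t
  by_contra! ht
  refine h (((Set.finite_Iic t).biUnion fun s _ => finite_setOf_reaches o ω s).subset ?_)
  rintro v ⟨s, hs⟩
  obtain ⟨r, hrt, hr⟩ := exists_reaches_le_of_forall_not_activeAt ht hs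
  exact Set.mem_biUnion hrt hr

lemma survives_of_forall_exists_le_length {α : Type*} {f : List α → V} (hf : Function.Injective f)
    (h : ∀ k, ∃ l, (∃ t, Reaches o ω (f l) t) ∧ k ≤ l.length) : Survives o ω := by
  refine survives_of_infinite fun hfin => ?_
  obtain ⟨k, hk⟩ := ((hfin.preimage hf.injOn).image List.length).bddAbove
  obtain ⟨l, hl, hkl⟩ := h (k + 1)
  exact absurd (hk ⟨l, hl, rfl⟩) (by omega)

lemma exists_reaches_of_mem_visits {G : SimpleGraph V} (h : Reaches o ω v t)
    (hw : ω v ∈ visits G v w) : ∃ s, Reaches o ω w s := by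
  obtain ⟨-, n, hn, rfl⟩ := hw
  exact ⟨t + n, Reaches.step h hn⟩

end Reachability

section Survival

variable {V : Type*} {G : SimpleGraph V} {p : unitInterval} {d : ℕ}

lemma measureReal_frogLaw_eval_preimage [IsProbabilityMeasure (particleLaw G p)] (v : V)
    {S : Set (Particle V)} (hS : MeasurableSet S) :
    (frogLaw G p).real {ω | ω v ∈ S} = (particleLaw G p).real S :=
  (measurePreserving_eval_infinitePi (fun _ : V => particleLaw G p) v).measureReal_preimage
    hS.nullMeasurableSet

lemma iIndep_comap_eval_frogLaw [IsProbabilityMeasure (particleLaw G p)] {ι : Type*} {f : ι → V}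
    (hf : Function.Injective f) :
    iIndep (fun i => MeasurableSpace.comap (fun ω : V → Particle V => ω (f i)) inferInstance)
      (frogLaw G p) :=
  (iIndepFun_infinitePi (P := fun _ : V => particleLaw G p) (X := fun _ π => π)
    fun _ => measurable_id).precomp hf

variable [G.LocallyFinite]

theorem survivalProb_pos_of_one_lt (hG : G.IsTree) (hdeg : ∀ v, d + 1 ≤ G.degree v) (o : V)
    {q : ℕ → ℝ} (hq : ∀ x w, (particleLaw G p).real (visits G x w) = q (G.dist x w))
    (hq1 : 0 < q 1) {N : ℕ} (hN : 1 < ∑ i ∈ Finset.range N, (d : ℝ) ^ (i + 1) * lastHit q i) :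
    0 < survivalProb G o p := by
  have := countable_of_locallyFinite hG.connected
  have hpL : IsProbabilityMeasure (particleLaw G p) :=
    isProbabilityMeasure_particleLaw fun v => by have := hdeg v; omega
  have hpF : IsProbabilityMeasure (frogLaw G p) := by unfold frogLaw; infer_instance
  obtain ⟨f, hf0, hfinj, hfdist⟩ := exists_word_embedding hG hdeg o
  obtain ⟨S, hS, hSR⟩ := exists_measure_pos_of_one_lt (μ := frogLaw G p) (q := q) (N := N)
    (A := fun l s => {ω | ω (f l) ∈ visits G (f l) (f (s ++ l))})
    (fun l => (measurable_pi_apply (f l)).comap_le) (iIndep_comap_eval_frogLaw hfinj)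
    (fun l s => ⟨_, measurableSet_visits (f l) (f (s ++ l)), rfl⟩)
    (fun l s => by
      rw [measureReal_frogLaw_eval_preimage _ (measurableSet_visits _ _), hq, hfdist])
    hq1
    (fun l s t _ hω => visits_subset_of_dist_add_dist hG (by
      rw [hfdist, List.append_assoc, hfdist, ← List.append_assoc, hfdist, List.length_append,
        add_comm]) hω)
    (by simpa only [Fintype.card_fin] using hN)
  refine hS.trans_le (measure_mono fun ω hω => survives_of_forall_exists_le_length hfinj ?_)
  exact hSR ω hω (fun l => ∃ t, Reaches o ω (f l) t) ⟨0, hf0 ▸ Reaches.root⟩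
    fun l s ⟨_, ht⟩ hs => exists_reaches_of_mem_visits ht hs

/-- The parameter of the frog model on the homogeneous tree of degree `d + 1` for which a particle
ever visits a given neighbour of its starting vertex with probability `b`. -/
noncomputable def paramOfHitProb (d b : ℝ) : ℝ :=
  (d + 1) * b / (1 + d * b ^ 2)

lemma paramOfHitProb_pos {d b : ℝ} (hd : 0 ≤ d) (hb : 0 < b) : 0 < paramOfHitProb d b := by
  unfold paramOfHitProb
  positivity

lemma paramOfHitProb_lt_one {d b : ℝ} (hd : 0 ≤ d) (hb : b < 1) (hdb : d * b < 1) :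
    paramOfHitProb d b < 1 := by
  rw [paramOfHitProb, div_lt_one (by positivity)]
  nlinarith only [mul_pos (sub_pos.2 hb) (sub_pos.2 hdb)]

theorem paramOfHitProb_mem_supercritical (hG : G.IsTree) (hreg : G.IsRegularOfDegree (d + 1))
    (o : V) {b : ℝ} (hb0 : 0 < b) (hb1 : b < 1) (hdb : d * b < 1) {N : ℕ}
    (hN : 1 < ∑ i ∈ Finset.range N, (d : ℝ) ^ (i + 1) * lastHit (fun k => b ^ k) i) :
    paramOfHitProb d b ∈ supercritical G o := by
  have hp0 := paramOfHitProb_pos d.cast_nonneg hb0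
  have hp1 := paramOfHitProb_lt_one d.cast_nonneg hb1 hdb
  refine ⟨⟨paramOfHitProb d b, hp0.le, hp1.le⟩, rfl, hp0, hp1,
    survivalProb_pos_of_one_lt hG (fun v => (hreg v).ge) o (fun x w => ?_) ?_ hN⟩
  · rw [measureReal_visits_eq_pow_dist hG hreg hp1 hb0.le hb1.le _, SimpleGraph.dist_comm]
    exact div_mul_cancel₀ _ (by positivity)
  · simpa only [pow_one] using hb0

end Survival

section Numerics

lemma one_sub_sub_sq_add_pow_le_prod {b : ℝ} (hb0 : 0 ≤ b) (hb1 : b ≤ 1) (n : ℕ) :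
    1 - b - b ^ 2 + b ^ (n + 2) ≤ ∏ j ∈ Finset.range (n + 1), (1 - b ^ (j + 1)) := by
  induction n with
  | zero => simp
  | succ n ih =>
    have hsq : b ^ (n + 2) * b ^ (n + 2) ≤ b ^ (n + 2) * b ^ 2 :=
      mul_le_mul_of_nonneg_left (pow_le_pow_of_le_one hb0 hb1 (by omega)) (by positivity)
    calc 1 - b - b ^ 2 + b ^ (n + 3)
        ≤ (1 - b - b ^ 2 + b ^ (n + 2)) * (1 - b ^ (n + 2)) := by
          rw [pow_succ b (n + 2)]
          linarith only [hsq]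
      _ ≤ (∏ j ∈ Finset.range (n + 1), (1 - b ^ (j + 1))) * (1 - b ^ (n + 2)) :=
          mul_le_mul_of_nonneg_right ih (sub_nonneg.2 (pow_le_one₀ hb0 hb1))
      _ = ∏ j ∈ Finset.range (n + 2), (1 - b ^ (j + 1)) := (Finset.prod_range_succ _ _).symm

lemma exists_one_lt_sum_lastHit {d b : ℝ} (hb0 : 0 < b) (hb1 : b < 1) (hd : 0 < d)
    (hdb : d * b < 1) (h : (b + b ^ 2) * (d * b) ^ 2 < 2 * (d * b) - 1) :
    ∃ N, 1 < ∑ i ∈ Finset.range N, d ^ (i + 1) * lastHit (fun k => b ^ k) i := by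
  have hlim : Filter.Tendsto (fun N : ℕ => d * b + (1 - b - b ^ 2) * (d * b) ^ 2 *
      ∑ i ∈ Finset.range N, (d * b) ^ i) Filter.atTop
      (nhds (d * b + (1 - b - b ^ 2) * (d * b) ^ 2 * (1 - d * b)⁻¹)) :=
    ((hasSum_geometric_of_lt_one (by positivity) hdb).tendsto_sum_nat.const_mul _).const_add _
  have hlim1 : 1 < d * b + (1 - b - b ^ 2) * (d * b) ^ 2 * (1 - d * b)⁻¹ := by
    rw [← sub_lt_iff_lt_add', ← div_eq_mul_inv, lt_div_iff₀ (sub_pos.2 hdb)]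
    linarith only [h]
  obtain ⟨N, hN⟩ := (hlim.eventually (lt_mem_nhds hlim1)).exists
  refine ⟨N + 1, hN.trans_le ?_⟩
  rw [Finset.sum_range_succ', add_comm, Finset.mul_sum]
  refine add_le_add (Finset.sum_le_sum fun i _ => ?_) (by simp [lastHit])
  have hprod : 1 - b - b ^ 2 ≤ ∏ j ∈ Finset.range (i + 1), (1 - b ^ (j + 1)) :=
    (le_add_of_nonneg_right (by positivity)).trans
      (one_sub_sub_sq_add_pow_le_prod hb0.le hb1.le i)
  calc (1 - b - b ^ 2) * (d * b) ^ 2 * (d * b) ^ i = (d * b) ^ (i + 2) * (1 - b - b ^ 2) := by ring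
    _ ≤ (d * b) ^ (i + 2) * ∏ j ∈ Finset.range (i + 1), (1 - b ^ (j + 1)) :=
        mul_le_mul_of_nonneg_left hprod (by positivity)
    _ = d ^ (i + 1 + 1) * lastHit (fun k => b ^ k) (i + 1) := by rw [lastHit]; ring

/-- The smaller root `b` of `(b + b ^ 2) * (2 / 7) = 2 * (d * b) - 1`. This is the equality case of
the condition of `exists_one_lt_sum_lastHit`, with `(d * b) ^ 2` replaced by its upper bound
`2 / 7`. -/
noncomputable def hitProbRoot (d : ℝ) : ℝ :=
  ((7 * d - 1) - √((7 * d - 1) ^ 2 - 14)) / 2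

section HitProbRoot

variable {d : ℝ}

lemma hitProbRoot_quadratic (hd : 3 ≤ d) :
    (hitProbRoot d + hitProbRoot d ^ 2) * (2 / 7) = 2 * (d * hitProbRoot d) - 1 := by
  have hsqrt := Real.sq_sqrt (by nlinarith only [hd] : 0 ≤ (7 * d - 1) ^ 2 - 14)
  unfold hitProbRoot
  linear_combination hsqrt / 14

lemma hitProbRoot_pos (hd : 3 ≤ d) : 0 < hitProbRoot d := by
  refine half_pos (sub_pos.2 ((Real.sqrt_lt' (by linarith only [hd])).2 ?_))
  linarith only

lemma hitProbRoot_lt (hd : 3 ≤ d) : hitProbRoot d < 0.18 := by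
  have hsqrt : 7 * d - 1 - 0.36 < √((7 * d - 1) ^ 2 - 14) :=
    Real.lt_sqrt_of_sq_lt (by nlinarith only [hd])
  unfold hitProbRoot
  linarith only [hsqrt]

lemma mul_hitProbRoot_lt (hd : 3 ≤ d) : d * hitProbRoot d < 0.5304 := by
  have hquad := hitProbRoot_quadratic hd
  nlinarith only [hquad, hitProbRoot_pos hd, hitProbRoot_lt hd]

lemma exists_one_lt_sum_lastHit_hitProbRoot (hd : 3 ≤ d) :
    ∃ N, 1 < ∑ i ∈ Finset.range N, d ^ (i + 1) * lastHit (fun k => hitProbRoot d ^ k) i := by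
  have hb0 := hitProbRoot_pos hd
  have hd0 : 0 < d := by linarith only [hd]
  have hdb := mul_hitProbRoot_lt hd
  have hsq : (d * hitProbRoot d) ^ 2 < 2 / 7 := by
    nlinarith only [hdb, mul_pos hd0 hb0]
  refine exists_one_lt_sum_lastHit hb0 (by linarith only [hitProbRoot_lt hd]) hd0
    (by linarith only [hdb]) ?_
  rw [← hitProbRoot_quadratic hd]
  exact mul_lt_mul_of_pos_left hsq (by positivity)

lemma paramOfHitProb_hitProbRoot (hd : 3 ≤ d) :
    paramOfHitProb d (hitProbRoot d) =
      ((d + 1) * ((7 * d - 1) - √((7 * d - 1) ^ 2 - 14))) /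
        (d * (7 * d - 1) ^ 2 - 7 * d + 2 - d * (7 * d - 1) * √((7 * d - 1) ^ 2 - 14)) := by
  have hsqrt := Real.sq_sqrt (by nlinarith only [hd] : 0 ≤ (7 * d - 1) ^ 2 - 14)
  unfold paramOfHitProb hitProbRoot
  rw [← mul_div_mul_left _ _ (two_ne_zero' ℝ)]
  congr 1
  · ring
  · linear_combination d / 2 * hsqrt

lemma paramOfHitProb_hitProbRoot_lt (hd : 3 ≤ d) :
    paramOfHitProb d (hitProbRoot d) < (d + 1) / (2 * d) := by
  have hd0 : 0 < d := by linarith only [hd]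
  have hb0 := hitProbRoot_pos hd
  have hquad := hitProbRoot_quadratic hd
  rw [paramOfHitProb, div_lt_div_iff₀ (by positivity) (by positivity), mul_assoc]
  refine mul_lt_mul_of_pos_left ?_ (by positivity)
  nlinarith only [hquad, hb0, mul_hitProbRoot_lt hd, mul_pos hb0 hb0,
    mul_pos (mul_pos hd0 hb0) hb0]

end HitProbRoot

end Numerics

section CriticalParam

variable {V : Type*} {G : SimpleGraph V}

lemma criticalParam_le {o : V} {x : ℝ} (hx : x ∈ supercritical G o) : criticalParam G o ≤ x :=
  csInf_le ⟨0, fun _ ⟨p, hp, _⟩ => hp ▸ p.2.1⟩ hx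

variable [G.LocallyFinite]

lemma paramOfHitProb_two_mem_supercritical (hG : G.IsTree) (hreg : G.IsRegularOfDegree 3) (o : V) :
    paramOfHitProb 2 0.277 ∈ supercritical G o := by
  have hN : 1 < ∑ i ∈ Finset.range 7, ((2 : ℕ) : ℝ) ^ (i + 1) * lastHit (fun k => 0.277 ^ k) i := by
    simp only [lastHit, Finset.sum_range_succ, Finset.prod_range_succ, Finset.range_zero,
      Finset.sum_empty, Finset.prod_empty]
    norm_num
  exact_mod_cast paramOfHitProb_mem_supercritical hG hreg o (by norm_num) (by norm_num)
    (by norm_num) hN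

lemma paramOfHitProb_hitProbRoot_mem_supercritical (hG : G.IsTree) {d : ℕ} (hd : 3 ≤ d)
    (hreg : G.IsRegularOfDegree (d + 1)) (o : V) :
    paramOfHitProb d (hitProbRoot d) ∈ supercritical G o := by
  have hd' : (3 : ℝ) ≤ d := by exact_mod_cast hd
  obtain ⟨N, hN⟩ := exists_one_lt_sum_lastHit_hitProbRoot hd'
  exact paramOfHitProb_mem_supercritical hG hreg o (hitProbRoot_pos hd')
    (by linarith only [hitProbRoot_lt hd']) (by linarith only [mul_hitProbRoot_lt hd']) hN

end CriticalParam

end FrogModel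

theorem proposition2 {V : Type*} (G : SimpleGraph V) [G.LocallyFinite] (o : V) (d : ℕ)
    (hd : 2 ≤ d) (hG : G.IsTree) (hreg : G.IsRegularOfDegree (d + 1)) :
    (FrogModel.supercritical G o).Nonempty ∧
    (d = 2 → FrogModel.criticalParam G o ≤ 0.720836) ∧
    (3 ≤ d →
      FrogModel.criticalParam G o ≤
        (((d : ℝ) + 1) * ((7 * (d : ℝ) - 1) - √((7 * (d : ℝ) - 1) ^ 2 - 14))) /
          ((d : ℝ) * (7 * (d : ℝ) - 1) ^ 2 - 7 * (d : ℝ) + 2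
            - (d : ℝ) * (7 * (d : ℝ) - 1) * √((7 * (d : ℝ) - 1) ^ 2 - 14)) ∧
      (((d : ℝ) + 1) * ((7 * (d : ℝ) - 1) - √((7 * (d : ℝ) - 1) ^ 2 - 14))) /
          ((d : ℝ) * (7 * (d : ℝ) - 1) ^ 2 - 7 * (d : ℝ) + 2
            - (d : ℝ) * (7 * (d : ℝ) - 1) * √((7 * (d : ℝ) - 1) ^ 2 - 14))
        < ((d : ℝ) + 1) / (2 * (d : ℝ))) := by
  have h2 (hd2 : d = 2) : FrogModel.paramOfHitProb 2 0.277 ∈ FrogModel.supercritical G o := by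
    subst hd2
    exact FrogModel.paramOfHitProb_two_mem_supercritical hG hreg o
  have h3 (hd3 : 3 ≤ d) :
      FrogModel.paramOfHitProb d (FrogModel.hitProbRoot d) ∈ FrogModel.supercritical G o :=
    FrogModel.paramOfHitProb_hitProbRoot_mem_supercritical hG hd3 hreg o
  refine ⟨?_, fun hd2 => ?_, fun hd3 => ?_⟩
  · exact hd.eq_or_lt.elim (fun hd2 => ⟨_, h2 hd2.symm⟩) fun hd3 => ⟨_, h3 hd3⟩
  · exact (FrogModel.criticalParam_le (h2 hd2)).trans (by norm_num [FrogModel.paramOfHitProb])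
  · have hd3' : (3 : ℝ) ≤ d := by exact_mod_cast hd3
    rw [← FrogModel.paramOfHitProb_hitProbRoot hd3']
    exact ⟨FrogModel.criticalParam_le (h3 hd3), FrogModel.paramOfHitProb_hitProbRoot_lt hd3'⟩
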